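/- Let $M$ be a smooth (Hausdorff) manifold of dimension $m\ge 2$, let $C\to M$ be the bundle of linear connections of $TM$ and $C_\Gamma\subset C$ the subbundle of symmetric (torsion-free) ones, with induced coordinates $(x^a,y_a{}^b{}_c)$ on $C$ and $(x^a,y_a{}^b{}_c,y_a{}^b{}_{c,d})$ on the first jet bundle $JC$. Conventions: a connection $\Gamma$ has $\nabla_aZ^b=\partial_aZ^b-\Gamma_a{}^b{}_cZ^c$, its curvature is $R_{ab}{}^c{}_d=\partial_b\Gamma_a{}^c{}_d-\partial_a\Gamma_b{}^c{}_d+\Gamma_a{}^c{}_e\Gamma_b{}^e{}_d-\Gamma_b{}^c{}_e\Gamma_a{}^e{}_d$ (that is, $R(U,V)=[\nabla_U,\nabla_V]-\nabla_{[U,V]}$), $R_{ac}=R_{ab}{}^b{}_c$, $R=g^{ac}R_{ac}$, and $\mathrm L_X\Gamma$ is the tensor field given by $\mathrm L_X\Gamma\rfloor Z=\nabla(\mathrm L_XZ)-\mathrm L_X(\nabla Z)$ for all vector fields $Z$. Put $d^mx=dx^1\wedge\dots\wedge dx^m$ and $dx_a=i_{\partial_a}d^mx$. In metric-affine gravity the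 fields are a pseudo-Riemannian metric $g$ and a connection, the Lagrangian density is $\ell\,d^mx$ with $\ell=R\sqrt{|g|}$ (as a function on the first jet bundle of the configuration bundle of pairs $(g,\Gamma)$, $\Gamma\in C$), and the gravitational Poincaré–Cartan form is $$\mathcal C_{grav}=\ell\,d^mx+\frac{\partial\ell}{\partial y_{b}{}^c{}_{d,a}}\,\bigl(dy_b{}^c{}_d-y_b{}^c{}_{d,e}\,dx^e\bigr)\wedge dx_a .$$ For a vector field $X$ on $M$ let $Y=X^a\,\partial x_a+Y_b{}^c{}_d\,\partial y^b{}_c{}^d:JC\to TC$ be the morphism over $C$ with $$Y_b{}^c{}_d\circ j\Gamma=X^e\partial_e\Gamma_b{}^c{}_d-(\mathrm L_X\Gamma)_b{}^c{}_d+R_{bd}{}^c{}_e[\Gamma]\,X^e-R_{bd}[\Gamma]\,X^c$$ (restricted to jets of symmetric connections it is a map $JC_\Gamma\to TC$). **Theorem.** Let $X$ be any smooth vector field on $M$. (1) For every smooth torsion-free connection $\Gamma$, along $j\Gamma$ one has, without coordinates, $Y=X\rfloor d\!l-\mathrm L_X\Gamma+\mathrm{Riemann}\rfloor X-\mathrm{Ricci}\otimes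 X$, where $X\rfloor d\!l=X^a(\partial x_a+\partial_a\Gamma_b{}^c{}_d\,\partial y^b{}_c{}^d)$, $(\mathrm{Riemann}\rfloor X)(U,V)=R(U,V)X$, and $\mathrm{Ricci}(U,V)$ is the trace of $w\mapsto R(U,w)V$. (2) For every smooth pseudo-Riemannian metric $g$ with Riemannian (torsion-free and metric, $\nabla g=0$) connection $\Gamma$ — no field equation for $g$ being assumed — $$j(g,\Gamma)^*\bigl(i_Y\,\mathcal C_{grav}\bigr)=\mathcal J[X]:=\tfrac12\,d{*}d\,(g^\flat X),\qquad g^\flat X=g_{ac}X^c\,dx^a,$$ in every chart of $M$. Here $i_Y\mathcal C_{grav}$ is $i_Z\mathcal C_{grav}$ for an arbitrary vector field $Z$ on the jet bundle of the configuration bundle projecting on $Y$, and for a 2-form $\varphi$ the Hodge isomorphism is normalized as $*\varphi=\varphi^{ab}\,i_{\partial_a}i_{\partial_b}\bigl(\sqrt{|g|}\,d^mx\bigr)$ with $\varphi^{ab}=g^{ac}g^{bd}\varphi(\partial_c,\partial_d)$, so that $\tfrac12 d{*}\varphi=\nabla_a\varphi^{ab}\sqrt{|g|}\,dx_b$. 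-/

import Mathlib

open scoped Manifold ContDiff Bundle

namespace MetricAffine

noncomputable section

/-! ### Coordinate space, elementary forms, jets -/

/-- The coordinate space `ℝ^m`, on which the spacetime manifold is modelled. -/
abbrev Vec (m : ℕ) : Type := EuclideanSpace ℝ (Fin m)

/-- The coordinate vector `∂x_a`. -/
def basisVec {m : ℕ} (a : Fin m) : Vec m := EuclideanSpace.single a 1

/-- The coordinate 1-form `dx^a`. -/
def dx {m : ℕ} (a : Fin m) : Vec m →L[ℝ] ℝ := EuclideanSpace.proj a

/-- The partial derivative `∂_a f`. -/
def pderiv {m : ℕ} (a : Fin m) (f : Vec m → ℝ) (x : Vec m) : ℝ := fderiv ℝ f x (basisVec a)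

/-- `d^m x = dx^1 ∧ ⋯ ∧ dx^m`. -/
def coordVol (m : ℕ) : Vec m [⋀^Fin m]→L[ℝ] ℝ :=
  ContinuousMultilinearMap.alternatization
    ((ContinuousMultilinearMap.mkPiAlgebra ℝ (Fin m) ℝ).compContinuousLinearMap fun a => dx a)

theorem coordVol_apply (m : ℕ) (v : Fin m → Vec m) :
    coordVol m v = Matrix.det (Matrix.of fun i j => v i j) := by
  rw [coordVol, ContinuousMultilinearMap.alternatization_apply_apply, Matrix.det_apply]
  rfl

/-- `dx_a = i_{∂x_a} d^m x`. -/
def dxBar {k : ℕ} (a : Fin (k + 1)) : Vec (k + 1) [⋀^Fin k]→L[ℝ] ℝ :=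
  (coordVol (k + 1)).curryLeft (basisVec a)

/-- The exterior product `α ∧ β` of a 1-form `α` and a `k`-form `β`:
`(α ∧ β)(v_0, …, v_k) = ∑ i, (-1)^i α(v_i) β(v_0, …, v_{i-1}, v_{i+1}, …, v_k)`. -/
def wedgeOne {V : Type*} [NormedAddCommGroup V] [NormedSpace ℝ V] {k : ℕ}
    (α : V →L[ℝ] ℝ) (β : V [⋀^Fin k]→L[ℝ] ℝ) : V [⋀^Fin (k + 1)]→L[ℝ] ℝ :=
  ContinuousAlternatingMap.alternatizeUncurryFin (α.smulRight β)

/-- The coordinate first jet space of a bundle over an `m`-manifold with fibre coordinates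
`(y^i)`, `i : ι`; its points are `(x^a, y^i, y^i_a)`. -/
abbrev Jet (m : ℕ) (ι : Type) : Type := Vec m × (ι → ℝ) × (ι → Fin m → ℝ)

/-- The first jet prolongation `jφ` of a local section `φ`. -/
def jetProlong {m : ℕ} {ι : Type} (φ : Vec m → ι → ℝ) (x : Vec m) : Jet m ι :=
  (x, φ x, fun i a => pderiv a (fun z => φ z i) x)

section PoincareCartan

variable {k : ℕ} {ι : Type} [Fintype ι]

/-- The contact form `ϑ^i = dy^i - y^i_b dx^b` at the jet `p`. -/
def contactForm (i : ι) (p : Jet (k + 1) ι) : Jet (k + 1) ι →L[ℝ] ℝ :=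
  (ContinuousLinearMap.proj i ∘L
      (ContinuousLinearMap.fst ℝ (ι → ℝ) (ι → Fin (k + 1) → ℝ) ∘L
        ContinuousLinearMap.snd ℝ (Vec (k + 1)) ((ι → ℝ) × (ι → Fin (k + 1) → ℝ)))) -
    ∑ b, p.2.2 i b • (dx b ∘L
      ContinuousLinearMap.fst ℝ (Vec (k + 1)) ((ι → ℝ) × (ι → Fin (k + 1) → ℝ)))

/-- The momentum `P^a_i = ∂ℓ/∂y^i_a`. -/
def momentum [DecidableEq ι] (ℓ : Jet (k + 1) ι → ℝ) (i : ι) (a : Fin (k + 1))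
    (p : Jet (k + 1) ι) : ℝ :=
  lineDeriv ℝ ℓ p (0, 0, Pi.single i (Pi.single a 1))

/-- The Poincaré–Cartan form `C = ℓ d^m x + P^a_i ϑ^i ∧ dx_a` of the Lagrangian density
`ℓ d^m x`, an `m`-form on the jet space. -/
def poincareCartan [DecidableEq ι] (ℓ : Jet (k + 1) ι → ℝ) (p : Jet (k + 1) ι) :
    Jet (k + 1) ι [⋀^Fin (k + 1)]→L[ℝ] ℝ :=
  ℓ p • (coordVol (k + 1)).compContinuousLinearMap
      (ContinuousLinearMap.fst ℝ (Vec (k + 1)) ((ι → ℝ) × (ι → Fin (k + 1) → ℝ))) +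
    ∑ i, ∑ a, momentum ℓ i a p •
      wedgeOne (contactForm i p) ((dxBar a).compContinuousLinearMap
        (ContinuousLinearMap.fst ℝ (Vec (k + 1)) ((ι → ℝ) × (ι → Fin (k + 1) → ℝ))))

/-- The interior product `i_Z α`. -/
def interiorProd {V : Type*} [NormedAddCommGroup V] [NormedSpace ℝ V] {k : ℕ}
    (Z : V → V) (α : V → V [⋀^Fin (k + 1)]→L[ℝ] ℝ) : V → V [⋀^Fin k]→L[ℝ] ℝ :=
  fun p => (α p).curryLeft (Z p)

/-- The pull-back `f^* α`. -/
def pullback {V W : Type*} [NormedAddCommGroup V] [NormedSpace ℝ V]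
    [NormedAddCommGroup W] [NormedSpace ℝ W] {k : ℕ}
    (f : V → W) (α : W → W [⋀^Fin k]→L[ℝ] ℝ) : V → V [⋀^Fin k]→L[ℝ] ℝ :=
  fun x => (α (f x)).compContinuousLinearMap (fderiv ℝ f x)

end PoincareCartan

/-! ### The metric-affine jet space, curvature and Lagrangian

A linear connection has the fibre coordinates `Γ_a^b_c`, stored at the index `(a, b, c)`, with the
sign convention `∇_a Z^b = ∂_a Z^b - Γ_a^b_c Z^c`. -/

/-- Indices `(a, b, c)` of the fibre coordinates `y_a^b_c` of the bundle `C` of linear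
connections. -/
abbrev ConnIdx (m : ℕ) : Type := Fin m × Fin m × Fin m

/-- Indices of the fibre coordinates of the metric-affine configuration bundle: `inl (a, b)` for
`g_{ab}` and `inr (a, b, c)` for `y_a^b_c`. -/
abbrev FieldIdx (m : ℕ) : Type := (Fin m × Fin m) ⊕ ConnIdx m

section Formal

variable {m : ℕ}

/-- The metric matrix `(g_{ab})` at a jet. -/
def Jet.metric (p : Jet m (FieldIdx m)) : Matrix (Fin m) (Fin m) ℝ :=
  Matrix.of fun a b => p.2.1 (Sum.inl (a, b))

/-- The projection on the first jet space `JC` of the bundle of linear connections. -/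
def Jet.conn (p : Jet m (FieldIdx m)) : Jet m (ConnIdx m) :=
  (p.1, fun i => p.2.1 (Sum.inr i), fun i a => p.2.2 (Sum.inr i) a)

/-- The formal curvature tensor
`R_{ab}^c_d = ∂_b Γ_a^c_d - ∂_a Γ_b^c_d + Γ_a^c_e Γ_b^e_d - Γ_b^c_e Γ_a^e_d`. -/
def riemann (q : Jet m (ConnIdx m)) (a b c d : Fin m) : ℝ :=
  q.2.2 (a, c, d) b - q.2.2 (b, c, d) a +
    ∑ e, (q.2.1 (a, c, e) * q.2.1 (b, e, d) - q.2.1 (b, c, e) * q.2.1 (a, e, d))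

/-- The formal Ricci tensor `R_{ac} = R_{ab}^b_c`. -/
def ricci (q : Jet m (ConnIdx m)) (a c : Fin m) : ℝ := ∑ b, riemann q a b b c

/-- The gravitational Lagrangian `ℓ = R √|g|`, `R = g^{ac} R_{ab}^b_c`. -/
def gravLagrangian (p : Jet m (FieldIdx m)) : ℝ :=
  (∑ a, ∑ c, p.metric⁻¹ a c * ricci p.conn a c) * Real.sqrt |p.metric.det|

/-- The components `(L_X Γ)_a^b_c = -∂_{ac} X^b + ∂_a X^d Γ_d^b_c + Γ_a^b_d ∂_c X^d
- Γ_a^d_c ∂_d X^b + X^d ∂_d Γ_a^b_c` of the Lie derivative of a linear connection. -/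
def lieConn (X : Vec m → Vec m) (q : Jet m (ConnIdx m)) (a b c : Fin m) : ℝ :=
  -pderiv a (pderiv c fun z => X z b) q.1 +
    ∑ d, (pderiv a (fun z => X z d) q.1 * q.2.1 (d, b, c) +
      q.2.1 (a, b, d) * pderiv c (fun z => X z d) q.1 -
      q.2.1 (a, d, c) * pderiv d (fun z => X z b) q.1 +
      X q.1 d * q.2.2 (a, b, c) d)

/-- The morphism `Y : JC → TC` over `C`, `Y = X^a ∂x_a + Y_b^c_d ∂y^b_c^d` with
`Y_b^c_d = X^e Γ_b^c_{d,e} - (L_X Γ)_b^c_d + R_{bd}^c_e X^e - R_{bd} X^c`. -/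
def komarLift (X : Vec m → Vec m) (q : Jet m (ConnIdx m)) : Vec m × (ConnIdx m → ℝ) :=
  (X q.1, fun i => (∑ e, X q.1 e * q.2.2 i e) - lieConn X q i.1 i.2.1 i.2.2 +
    (∑ e, riemann q i.1 i.2.2 i.2.1 e * X q.1 e) - ricci q i.1 i.2.2 * X q.1 i.2.1)

end Formal

/-! ### The current -/

section Current

variable {n : ℕ}

/-- The Hodge isomorphism on 2-forms, `*φ = φ^{ab} i_{∂a} i_{∂b} η` with `η = √|g| d^m x` and
`φ^{ab} = g^{ac} g^{bd} φ(∂_c, ∂_d)`; this is the normalization for which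
`½ d * φ = ∇_a φ^{ab} √|g| dx_b`. -/
def hodgeTwo (G : Matrix (Fin (n + 2)) (Fin (n + 2)) ℝ) (φ : Vec (n + 2) [⋀^Fin 2]→L[ℝ] ℝ) :
    Vec (n + 2) [⋀^Fin n]→L[ℝ] ℝ :=
  ∑ a, ∑ b, ((∑ c, ∑ d, G⁻¹ a c * G⁻¹ b d * φ ![basisVec c, basisVec d]) *
      Real.sqrt |G.det|) • (dxBar b).curryLeft (basisVec a)

/-- The 1-form `g♭(X) = g_{ac} X^c dx^a`. -/
def flatForm (G : Vec (n + 2) → Matrix (Fin (n + 2)) (Fin (n + 2)) ℝ)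
    (X : Vec (n + 2) → Vec (n + 2)) (z : Vec (n + 2)) : Vec (n + 2) [⋀^Fin 1]→L[ℝ] ℝ :=
  ContinuousAlternatingMap.ofSubsingleton ℝ (Vec (n + 2)) ℝ (0 : Fin 1)
    (∑ a, (∑ c, G z a c * X z c) • dx a)

/-- The current `J[X] = ½ d * d (g♭ X)`. -/
def komarCurrent (G : Vec (n + 2) → Matrix (Fin (n + 2)) (Fin (n + 2)) ℝ)
    (X : Vec (n + 2) → Vec (n + 2)) (z : Vec (n + 2)) : Vec (n + 2) [⋀^Fin (n + 1)]→L[ℝ] ℝ :=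
  (1 / 2 : ℝ) • extDeriv (fun w => hodgeTwo (G w) (extDeriv (flatForm G X) w)) z

end Current

/-! ### Fields on a manifold and their coordinate expressions -/

section Manifold

variable {m : ℕ} {M : Type*} [TopologicalSpace M] [ChartedSpace (Vec m) M]
  [IsManifold (𝓡 m) ∞ M]

variable (m M) in
/-- A smooth pseudo-Riemannian metric (of any signature) on `M`. -/
structure PseudoMetric where
  inner (x : M) : TangentSpace (𝓡 m) x →L[ℝ] TangentSpace (𝓡 m) x →L[ℝ] ℝ
  symm (x : M) (v w : TangentSpace (𝓡 m) x) : inner x v w = inner x w v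
  nondegenerate (x : M) (v : TangentSpace (𝓡 m) x) (hv : ∀ w, inner x v w = 0) : v = 0
  contMDiff : ContMDiff (𝓡 m) ((𝓡 m).prod 𝓘(ℝ, Vec m →L[ℝ] Vec m →L[ℝ] ℝ)) ∞
    (fun x => Bundle.TotalSpace.mk' (Vec m →L[ℝ] Vec m →L[ℝ] ℝ)
      (E := fun x : M => TangentSpace (𝓡 m) x →L[ℝ] TangentSpace (𝓡 m) x →L[ℝ] ℝ)
      x (inner x))

variable (m M) in
/-- Linear connections of `TM → M`. -/
abbrev LinearConnection := CovariantDerivative (𝓡 m) (Vec m) (TangentSpace (𝓡 m) : M → Type _)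

/-- Metricity, `∇g = 0`: `u(g(U, V)) = g(∇_u U, V) + g(U, ∇_u V)`. -/
def IsMetric (cov : LinearConnection m M) (g : PseudoMetric m M) : Prop :=
  ∀ (x : M) (u : TangentSpace (𝓡 m) x) (U V : Π y : M, TangentSpace (𝓡 m) y),
    MDifferentiableAt (𝓡 m) (𝓡 m).tangent (fun y => (⟨y, U y⟩ : TangentBundle (𝓡 m) M)) x →
    MDifferentiableAt (𝓡 m) (𝓡 m).tangent (fun y => (⟨y, V y⟩ : TangentBundle (𝓡 m) M)) x →
    mvfderiv (𝓡 m) (fun y => g.inner y (U y) (V y)) x u =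
      g.inner x (cov U x u) (V x) + g.inner x (U x) (cov V x u)

/-- The curvature `R(U, V)W = ∇_U ∇_V W - ∇_V ∇_U W - ∇_{[U,V]} W`. -/
def curvature (cov : LinearConnection m M) (U V W : Π y : M, TangentSpace (𝓡 m) y) (x : M) :
    TangentSpace (𝓡 m) x :=
  cov (fun y => cov W y (V y)) x (U x) - cov (fun y => cov W y (U y)) x (V x) -
    cov W x (VectorField.mlieBracket (𝓡 m) U V x)

/-- The Lie derivative of a connection, `L_X Γ ⌋ Z = ∇(L_X Z) - L_X(∇Z)`, evaluated on `U`;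
here `(L_X A)(U) = [X, A(U)] - A([X, U])` for the endomorphism field `A = ∇Z`. -/
def lieDerivConnection (cov : LinearConnection m M) (X U Z : Π y : M, TangentSpace (𝓡 m) y)
    (x : M) : TangentSpace (𝓡 m) x :=
  cov (VectorField.mlieBracket (𝓡 m) X Z) x (U x) -
    (VectorField.mlieBracket (𝓡 m) X (fun y => cov Z y (U y)) x -
      cov Z x (VectorField.mlieBracket (𝓡 m) X U x))

/-- The coordinate vector field `∂x_a` of the chart `e` (meaningful on `e.source`). -/
def coordField (e : OpenPartialHomeomorph M (Vec m)) (a : Fin m) (x : M) :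
    TangentSpace (𝓡 m) x :=
  (mfderiv (𝓡 m) (𝓡 m) e x).inverse (basisVec a)

/-- The components in the chart `e` of a tangent vector at `x`. -/
def components (e : OpenPartialHomeomorph M (Vec m)) (x : M) (v : TangentSpace (𝓡 m) x) : Vec m :=
  mfderiv (𝓡 m) (𝓡 m) e x v

/-- The coordinate expression `X^a` of a vector field. -/
def vectorCoord (e : OpenPartialHomeomorph M (Vec m)) (X : Π y : M, TangentSpace (𝓡 m) y)
    (z : Vec m) : Vec m :=
  components e (e.symm z) (X (e.symm z))

/-- The coordinate expression `g_{ab}` of a metric. -/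
def metricCoord (e : OpenPartialHomeomorph M (Vec m)) (g : PseudoMetric m M) (z : Vec m) :
    Matrix (Fin m) (Fin m) ℝ :=
  Matrix.of fun a b =>
    g.inner (e.symm z) (coordField e a (e.symm z)) (coordField e b (e.symm z))

/-- The coordinate expression `Γ_a^b_c` of a connection; `∇_{∂a} ∂_c = -Γ_a^b_c ∂_b`. -/
def connCoord (e : OpenPartialHomeomorph M (Vec m)) (cov : LinearConnection m M) (z : Vec m) :
    ConnIdx m → ℝ :=
  fun i => -components e (e.symm z)
    (cov (coordField e i.2.2) (e.symm z) (coordField e i.1 (e.symm z))) i.2.1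

/-- The coordinate expression of the metric-affine field `(g, Γ)`. -/
def fieldCoord (e : OpenPartialHomeomorph M (Vec m)) (g : PseudoMetric m M)
    (cov : LinearConnection m M) (z : Vec m) : FieldIdx m → ℝ :=
  Sum.elim (fun i => metricCoord e g z i.1 i.2) (connCoord e cov z)

/-- The components `W_b^c_d` of the tensor field
`W = -L_X Γ + Riemann ⌋ X - Ricci ⊗ X : M → T*M ⊗ TM ⊗ T*M`,
where `(Riemann ⌋ X)(U, V) = R(U, V)X` and `Ricci(U, V)` is the trace of `w ↦ R(U, w)V`. -/
def verticalPart (e : OpenPartialHomeomorph M (Vec m)) (cov : LinearConnection m M)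
    (X : Π y : M, TangentSpace (𝓡 m) y) (z : Vec m) (b c d : Fin m) : ℝ :=
  -components e (e.symm z)
      (lieDerivConnection cov X (coordField e b) (coordField e d) (e.symm z)) c +
    components e (e.symm z) (curvature cov (coordField e b) (coordField e d) X (e.symm z)) c -
    (∑ a, components e (e.symm z)
      (curvature cov (coordField e b) (coordField e a) (coordField e d) (e.symm z)) a) *
      vectorCoord e X z c

end Manifold

end

end MetricAffine

namespace MetricAffine

open Filter Topology Finset

/-! ### Partial derivatives -/

section Pderiv

variable {m : ℕ} {f g : Vec m → ℝ} {x : Vec m} {a : Fin m}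

/-! Both claims are local, so everything is reduced to a chart, where the pair $(g,\Gamma)$ becomes
a matrix $G$ and coefficients subject to `IsLeviCivitaOn`: invertibility, symmetry, vanishing
torsion and $\nabla g=0$.

Contact forms vanish along a prolonged section, so in $j(g,\Gamma)^*i_Z\mathcal C$ only $\ell
X^a+P^a_i\,\vartheta^i(Z)$ survives as the coefficient of $dx_a$
(`pullback_interiorProd_poincareCartan`). The Lagrangian contains no derivatives of $g$ and is
affine in those of $\Gamma$. Hence only the connection part $W=-\mathrm
L_X\Gamma+\mathrm{Riemann}\rfloor X-\mathrm{Ricci}\otimes X$ contributes, with weight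
$\sqrt{|g|}(\delta^a_c g^{bd}-\delta^c_b g^{ad})$ (`momentum_gravLagrangian_conn`).

Without torsion, $-(\mathrm L_X\Gamma)_b{}^c{}_d=\nabla_b\nabla_dX^c+X^eR_{eb}{}^c{}_d$
(`lieConn_jetProlong`). After contraction $\mathrm{Ricci}\otimes X$ cancels $\ell X^a$, one Riemann
term dies by antisymmetry, and the other four equal $\pm R^a{}_eX^e$ and cancel in pairs
(`sum_momentum_komar_algebra`). This cancellation needs only symmetries of the curvature, which is
why no field equation enters.

What remains is $\sqrt{|g|}\,\nabla_b(\nabla^bX^a-\nabla^aX^b)$. For an antisymmetric tensor it is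
the ordinary divergence of the density (`divergence_contraDeriv`), and that is
$\tfrac12d{*}d(g^\flat X)$ in components (`komarCurrent_eq`). The first claim compares the invariant
curvature and Lie derivative with their coordinate formulas (`components_curvature`,
`components_lieDerivConnection`). -/

theorem pderiv_congr (h : f =ᶠ[𝓝 x] g) (a : Fin m) : pderiv a f x = pderiv a g x := by
  rw [pderiv, pderiv, h.fderiv_eq]

theorem pderiv_add (hf : DifferentiableAt ℝ f x) (hg : DifferentiableAt ℝ g x) (a : Fin m) :
    pderiv a (fun z => f z + g z) x = pderiv a f x + pderiv a g x := by
  simp [pderiv, fderiv_fun_add hf hg]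

theorem pderiv_sub (hf : DifferentiableAt ℝ f x) (hg : DifferentiableAt ℝ g x) (a : Fin m) :
    pderiv a (fun z => f z - g z) x = pderiv a f x - pderiv a g x := by
  simp [pderiv, fderiv_fun_sub hf hg]

theorem pderiv_neg (a : Fin m) : pderiv a (fun z => -f z) x = -pderiv a f x := by
  simp [pderiv, fderiv_fun_neg]

theorem pderiv_mul (hf : DifferentiableAt ℝ f x) (hg : DifferentiableAt ℝ g x) (a : Fin m) :
    pderiv a (fun z => f z * g z) x = pderiv a f x * g x + f x * pderiv a g x := by
  simp [pderiv, fderiv_fun_mul hf hg]; ring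

theorem pderiv_sum {ι : Type*} {s : Finset ι} {f : ι → Vec m → ℝ}
    (hf : ∀ i ∈ s, DifferentiableAt ℝ (f i) x) (a : Fin m) :
    pderiv a (fun z => ∑ i ∈ s, f i z) x = ∑ i ∈ s, pderiv a (f i) x := by
  simp [pderiv, fderiv_fun_sum hf]

theorem pderiv_sum_mul {ι : Type*} {s : Finset ι} {f g : ι → Vec m → ℝ}
    (hf : ∀ i, DifferentiableAt ℝ (f i) x) (hg : ∀ i, DifferentiableAt ℝ (g i) x) (a : Fin m) :
    pderiv a (fun z => ∑ i ∈ s, f i z * g i z) x =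
      ∑ i ∈ s, (pderiv a (f i) x * g i x + f i x * pderiv a (g i) x) := by
  rw [pderiv_sum (f := fun i z => f i z * g i z) fun i _ => (hf i).mul (hg i)]
  exact Finset.sum_congr rfl fun i _ => pderiv_mul (hf i) (hg i) a

theorem pderiv_const (c : ℝ) (a : Fin m) : pderiv a (fun _ => c) x = 0 := by
  simp [pderiv]

theorem pderiv_comp {φ : ℝ → ℝ} {φ' : ℝ} (hφ : HasDerivAt φ φ' (f x))
    (hf : DifferentiableAt ℝ f x) (a : Fin m) :
    pderiv a (fun z => φ (f z)) x = φ' * pderiv a f x := by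
  have := (hφ.comp_hasFDerivAt x hf.hasFDerivAt).fderiv
  simp only [pderiv]
  rw [show (fun z => φ (f z)) = φ ∘ f from rfl, this]
  simp

theorem pderiv_comm (hf : ContDiffAt ℝ ∞ f x) (a b : Fin m) :
    pderiv a (pderiv b f) x = pderiv b (pderiv a f) x := by
  have hd : DifferentiableAt ℝ (fderiv ℝ f) x :=
    (hf.fderiv_right (m := 1) (by decide)).differentiableAt (by simp)
  have key : ∀ a b : Fin m, pderiv a (pderiv b f) x =
      fderiv ℝ (fderiv ℝ f) x (basisVec a) (basisVec b) := fun a b => by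
    have := fderiv_clm_apply hd (differentiableAt_const (basisVec b))
    change fderiv ℝ (fun y => fderiv ℝ f y (basisVec b)) x (basisVec a) = _
    rw [this]
    simp
  rw [key, key]
  exact (hf.isSymmSndFDerivAt (by simp; decide)) _ _

theorem contDiffOn_pderiv {U : Set (Vec m)} (hU : IsOpen U) (hf : ContDiffOn ℝ ∞ f U)
    (a : Fin m) : ContDiffOn ℝ ∞ (pderiv a f) U :=
  (hf.fderiv_of_isOpen hU (m := ∞) (by simp)).clm_apply contDiffOn_const

theorem fderiv_apply_eq_sum_pderiv (v : Vec m) :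
    fderiv ℝ f x v = ∑ a, v a * pderiv a f x := by
  conv_lhs => rw [show v = ∑ a, v a • basisVec a from by
    simpa [basisVec] using ((EuclideanSpace.basisFun (Fin m) ℝ).sum_repr v).symm]
  simp [pderiv]

end Pderiv

/-! ### Levi-Civita connections in coordinates -/

/-- `Γ` is the Christoffel symbol of a Levi-Civita connection of the metric `G` on the open
coordinate domain `U`. -/
structure IsLeviCivitaOn {m : ℕ} (U : Set (Vec m)) (G : Vec m → Matrix (Fin m) (Fin m) ℝ)
    (Γ : Vec m → ConnIdx m → ℝ) : Prop where
  isOpen : IsOpen U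
  smooth_metric (a b : Fin m) : ContDiffOn ℝ ∞ (fun z => G z a b) U
  smooth_conn (i : ConnIdx m) : ContDiffOn ℝ ∞ (fun z => Γ z i) U
  det_ne_zero (z : Vec m) (hz : z ∈ U) : (G z).det ≠ 0
  metric_symm (z : Vec m) (hz : z ∈ U) (a b : Fin m) : G z a b = G z b a
  conn_symm (z : Vec m) (hz : z ∈ U) (a b c : Fin m) : Γ z (a, b, c) = Γ z (c, b, a)
  metricity (z : Vec m) (hz : z ∈ U) (a b c : Fin m) :
    pderiv c (fun w => G w a b) z =
      -∑ d, (Γ z (c, d, a) * G z d b + Γ z (c, d, b) * G z a d)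

section Coordinates

variable {m : ℕ}

/-- The covariant derivative `∇_c X^b` in coordinates. -/
noncomputable def covDeriv (Γ : Vec m → ConnIdx m → ℝ) (X : Vec m → Vec m) (c b : Fin m)
    (z : Vec m) : ℝ :=
  pderiv c (fun w => X w b) z - ∑ e, Γ z (c, b, e) * X z e

/-- The second covariant derivative `∇_a ∇_c X^b` in coordinates. -/
noncomputable def covDerivTwo (Γ : Vec m → ConnIdx m → ℝ) (X : Vec m → Vec m) (a c b : Fin m)
    (z : Vec m) : ℝ :=
  pderiv a (covDeriv Γ X c b) z - ∑ e, Γ z (a, b, e) * covDeriv Γ X c e z +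
    ∑ e, Γ z (a, e, c) * covDeriv Γ X e b z

variable {U : Set (Vec m)} {G : Vec m → Matrix (Fin m) (Fin m) ℝ} {Γ : Vec m → ConnIdx m → ℝ}
  {X : Vec m → Vec m}

theorem contDiffOn_covDeriv (hU : IsOpen U) (hΓ : ∀ i, ContDiffOn ℝ ∞ (fun z => Γ z i) U)
    (hX : ∀ b, ContDiffOn ℝ ∞ (fun z => X z b) U) (c b : Fin m) :
    ContDiffOn ℝ ∞ (covDeriv Γ X c b) U :=
  (contDiffOn_pderiv hU (hX b) c).sub
    (ContDiffOn.sum fun e _ => (hΓ (c, b, e)).mul (hX e))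

theorem differentiableAt_of_contDiffOn {f : Vec m → ℝ} (hU : IsOpen U)
    (hf : ContDiffOn ℝ ∞ f U) {z : Vec m} (hz : z ∈ U) : DifferentiableAt ℝ f z :=
  (hf.contDiffAt (hU.mem_nhds hz)).differentiableAt (by simp)

theorem pderiv_covDeriv (hU : IsOpen U) (hΓ : ∀ i, ContDiffOn ℝ ∞ (fun z => Γ z i) U)
    (hX : ∀ b, ContDiffOn ℝ ∞ (fun z => X z b) U) {z : Vec m} (hz : z ∈ U) (a c b : Fin m) :
    pderiv a (covDeriv Γ X c b) z = pderiv a (pderiv c fun w => X w b) z -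
      ∑ e, (pderiv a (fun w => Γ w (c, b, e)) z * X z e +
        Γ z (c, b, e) * pderiv a (fun w => X w e) z) := by
  have dΓ := fun i => differentiableAt_of_contDiffOn hU (hΓ i) hz
  have dX := fun i => differentiableAt_of_contDiffOn hU (hX i) hz
  rw [← pderiv_sum_mul (fun e => dΓ (c, b, e)) dX]
  exact pderiv_sub (differentiableAt_of_contDiffOn hU (contDiffOn_pderiv hU (hX b) c) hz)
    (DifferentiableAt.fun_sum fun e _ => (dΓ _).mul (dX _)) a

/-- Symmetry of $\Gamma$ alone suffices here; no metric is involved. It lets the non-tensorial terms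
regroup into a second covariant derivative and a curvature term. -/
theorem lieConn_jetProlong (hU : IsOpen U) (hΓ : ∀ i, ContDiffOn ℝ ∞ (fun z => Γ z i) U)
    (hX : ∀ b, ContDiffOn ℝ ∞ (fun z => X z b) U)
    (hs : ∀ z ∈ U, ∀ a b c, Γ z (a, b, c) = Γ z (c, b, a)) {z : Vec m} (hz : z ∈ U)
    (a b c : Fin m) :
    lieConn X (jetProlong Γ z) a b c =
      -covDerivTwo Γ X a c b z - ∑ e, X z e * riemann (jetProlong Γ z) e a b c := by
  -- The symmetry holds on a whole neighbourhood of `z`, so it may be differentiated.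
  have e2 : ∀ e, pderiv a (fun w => Γ w (c, b, e)) z = pderiv a (fun w => Γ w (e, b, c)) z :=
    fun e => pderiv_congr ((hU.mem_nhds hz |> fun h => Filter.mem_of_superset h
      fun w hw => hs w hw c b e)) a
  have q1 : ∑ e, Γ z (a, b, e) * ∑ d, Γ z (c, e, d) * X z d =
      ∑ e, X z e * ∑ d, Γ z (a, b, d) * Γ z (e, d, c) := by
    simp only [Finset.mul_sum]
    rw [Finset.sum_comm]
    refine Finset.sum_congr rfl fun e _ => Finset.sum_congr rfl fun d _ => ?_
    rw [hs z hz c d e]; ring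
  have q2 : ∑ e, Γ z (a, e, c) * ∑ d, Γ z (e, b, d) * X z d =
      ∑ e, X z e * ∑ d, Γ z (e, b, d) * Γ z (a, d, c) := by
    simp only [Finset.mul_sum]
    rw [Finset.sum_comm]
    refine Finset.sum_congr rfl fun e _ => Finset.sum_congr rfl fun d _ => ?_
    rw [hs z hz d b e]; ring
  simp only [lieConn, covDerivTwo, pderiv_covDeriv hU hΓ hX hz, riemann, jetProlong, covDeriv, mul_sub, mul_add,
    Finset.sum_add_distrib, Finset.sum_sub_distrib, q1, q2, e2]
  have r1 : ∑ e, Γ z (c, b, e) * pderiv a (fun w => X w e) z =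
      ∑ d, pderiv a (fun w => X w d) z * Γ z (d, b, c) :=
    Finset.sum_congr rfl fun e _ => by rw [hs z hz c b e]; ring
  have r2 : ∑ e, pderiv a (fun w => Γ w (e, b, c)) z * X z e =
      ∑ e, X z e * pderiv a (fun w => Γ w (e, b, c)) z :=
    Finset.sum_congr rfl fun e _ => by ring
  rw [r1, r2]
  ring

end Coordinates

/-! ### Derivative of the determinant; smoothness of the inverse matrix and of the volume density.
-/

section Determinant

variable {m : ℕ} {G : Vec m → Matrix (Fin m) (Fin m) ℝ} {U : Set (Vec m)}

/-- Jacobi's formula. -/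
theorem pderiv_det {z : Vec m} (hG : ∀ a b, DifferentiableAt ℝ (fun w => G w a b) z) (f : Fin m) :
    pderiv f (fun w => (G w).det) z =
      ∑ a, ∑ b, (G z).adjugate b a * pderiv f (fun w => G w a b) z := by
  -- Viewing the rows as vectors turns the determinant into the multilinear map `coordVol`, whose
  -- derivative replaces one row at a time.
  let v : Vec m → Fin m → Vec m := fun w a => WithLp.toLp 2 (G w a)
  have hv : DifferentiableAt ℝ v z := by
    rw [differentiableAt_pi]
    intro a
    rw [differentiableAt_euclidean]
    exact hG a
  have h1 : (fun w => (G w).det) = fun w => coordVol m (v w) := by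
    funext w
    rw [coordVol_apply]
    rfl
  have h2 := ((coordVol m).hasFDerivAt (v z)).comp z hv.hasFDerivAt
  have h3 : ∀ a b, fderiv ℝ v z (basisVec f) a b = pderiv f (fun w => G w a b) z := by
    intro a b
    have h4 : HasFDerivAt (fun w => v w a b)
        ((EuclideanSpace.proj (𝕜 := ℝ) b).comp ((ContinuousLinearMap.proj (R := ℝ)
          (φ := fun _ : Fin m => Vec m) a).comp (fderiv ℝ v z))) z :=
      (EuclideanSpace.proj (𝕜 := ℝ) b).hasFDerivAt.comp z
        ((ContinuousLinearMap.proj (R := ℝ) (φ := fun _ : Fin m => Vec m) a).hasFDerivAt.comp z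
          hv.hasFDerivAt)
    rw [pderiv, show (fun w => G w a b) = fun w => v w a b from rfl, h4.fderiv]
    rfl
  rw [pderiv, h1, show (fun w => coordVol m (v w)) = coordVol m ∘ v from rfl, h2.fderiv]
  rw [ContinuousLinearMap.comp_apply, ContinuousMultilinearMap.linearDeriv_apply]
  refine Finset.sum_congr rfl fun a _ => ?_
  have h5 : coordVol m (Function.update (v z) a (fderiv ℝ v z (basisVec f) a)) =
      ((G z).updateRow a fun b => pderiv f (fun w => G w a b) z).det := by
    rw [coordVol_apply]
    congr 1
    ext i j
    by_cases hi : i = a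
    · subst hi
      simp [h3]
    · simp [hi, v, Matrix.updateRow_ne]
  refine h5.trans ?_
  -- A determinant with one row replaced is a Cramer determinant, hence linear in that row with
  -- adjugate coefficients.
  rw [← Matrix.cramer_transpose_apply, Matrix.cramer_eq_adjugate_mulVec,
    ← Matrix.adjugate_transpose]
  simp [Matrix.mulVec, dotProduct, Matrix.transpose_apply]

theorem contDiffOn_det (hG : ∀ a b, ContDiffOn ℝ ∞ (fun w => G w a b) U) :
    ContDiffOn ℝ ∞ (fun w => (G w).det) U := by
  simp only [Matrix.det_apply]
  exact ContDiffOn.sum fun σ _ => (contDiffOn_prod fun i _ => hG _ _).const_smul _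

/-- By Cramer's rule each entry is an adjugate entry divided by the determinant, and an adjugate
entry is itself the determinant of a matrix with one constant row. -/
theorem contDiffOn_inv (hG : ∀ a b, ContDiffOn ℝ ∞ (fun w => G w a b) U)
    (hd : ∀ z ∈ U, (G z).det ≠ 0) (a b : Fin m) :
    ContDiffOn ℝ ∞ (fun w => (G w)⁻¹ a b) U := by
  simp only [Matrix.inv_def, Matrix.smul_apply, smul_eq_mul, Ring.inverse_eq_inv',
    Matrix.adjugate_apply]
  refine ((contDiffOn_det hG).inv hd).mul (contDiffOn_det fun i j => ?_)
  by_cases hi : i = b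
  · subst hi
    simpa using contDiffOn_const
  · simpa [Matrix.updateRow_ne, hi] using hG i j

theorem contDiffOn_sqrt_abs_det (hG : ∀ a b, ContDiffOn ℝ ∞ (fun w => G w a b) U)
    (hd : ∀ z ∈ U, (G z).det ≠ 0) :
    ContDiffOn ℝ ∞ (fun w => √|(G w).det|) U := by
  refine ContDiffOn.sqrt (fun z hz => ?_) fun z hz => (abs_pos.2 (hd z hz)).ne'
  exact (contDiffAt_abs (hd z hz)).comp_contDiffWithinAt z (contDiffOn_det hG z hz)

end Determinant

/-! ### Parallelism of the inverse metric and of the volume density. -/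

section

variable {m : ℕ} {U : Set (Vec m)} {G : Vec m → Matrix (Fin m) (Fin m) ℝ}
  {Γ : Vec m → ConnIdx m → ℝ} {X : Vec m → Vec m} {z : Vec m}

namespace IsLeviCivitaOn

theorem isUnit_det (h : IsLeviCivitaOn U G Γ) (hz : z ∈ U) : IsUnit (G z).det :=
  isUnit_iff_ne_zero.2 (h.det_ne_zero z hz)

theorem inv_symm (h : IsLeviCivitaOn U G Γ) (hz : z ∈ U) (a b : Fin m) :
    (G z)⁻¹ a b = (G z)⁻¹ b a := by
  have h1 : (G z).transpose = G z := by
    ext a b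
    exact h.metric_symm z hz b a
  conv_lhs => rw [← h1, ← Matrix.transpose_nonsing_inv]
  rfl

theorem smooth_inv (h : IsLeviCivitaOn U G Γ) (a b : Fin m) :
    ContDiffOn ℝ ∞ (fun w => (G w)⁻¹ a b) U :=
  contDiffOn_inv h.smooth_metric h.det_ne_zero a b

theorem smooth_sqrt (h : IsLeviCivitaOn U G Γ) : ContDiffOn ℝ ∞ (fun w => √|(G w).det|) U :=
  contDiffOn_sqrt_abs_det h.smooth_metric h.det_ne_zero

/-- This is $\nabla g^{-1}=0$, obtained by differentiating $G^{-1}G=1$ and inserting metricity in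
matrix form. -/
theorem pderiv_inv (h : IsLeviCivitaOn U G Γ) (hz : z ∈ U) (f a b : Fin m) :
    pderiv f (fun w => (G w)⁻¹ a b) z =
      ∑ d, Γ z (f, a, d) * (G z)⁻¹ d b + ∑ d, Γ z (f, b, d) * (G z)⁻¹ a d := by
  have dI := fun a b => differentiableAt_of_contDiffOn h.isOpen (h.smooth_inv a b) hz
  have dG := fun a b => differentiableAt_of_contDiffOn h.isOpen (h.smooth_metric a b) hz
  let DI : Matrix (Fin m) (Fin m) ℝ := Matrix.of fun a b => pderiv f (fun w => (G w)⁻¹ a b) z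
  let DG : Matrix (Fin m) (Fin m) ℝ := Matrix.of fun a b => pderiv f (fun w => G w a b) z
  let A : Matrix (Fin m) (Fin m) ℝ := Matrix.of fun d a => Γ z (f, d, a)
  have hDG : DG = -(A.transpose * G z + G z * A) := by
    ext a b
    simp only [DG, Matrix.of_apply, h.metricity z hz, Matrix.neg_apply, Matrix.add_apply,
      Matrix.mul_apply, Matrix.transpose_apply, A, ← Finset.sum_add_distrib]
    congr 1
    exact Finset.sum_congr rfl fun d _ => by ring
  have hprod : DI * G z + (G z)⁻¹ * DG = 0 := by
    ext a c
    have h1 : (fun w => ∑ b, (G w)⁻¹ a b * G w b c) =ᶠ[𝓝 z]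
        fun _ => (1 : Matrix (Fin m) (Fin m) ℝ) a c := by
      filter_upwards [h.isOpen.mem_nhds hz] with w hw
      rw [← Matrix.mul_apply, Matrix.nonsing_inv_mul _ (h.isUnit_det hw)]
    have h2 := pderiv_congr h1 f
    rw [pderiv_sum_mul (fun b => dI a b) (fun b => dG b c), pderiv_const] at h2
    simpa [Matrix.add_apply, Matrix.mul_apply, DI, DG, Finset.sum_add_distrib] using h2
  have hDI : DI = A * (G z)⁻¹ + (G z)⁻¹ * A.transpose := by
    have h3 : DI = -((G z)⁻¹ * DG) * (G z)⁻¹ := by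
      rw [← eq_neg_of_add_eq_zero_left hprod, Matrix.mul_assoc,
        Matrix.mul_nonsing_inv _ (h.isUnit_det hz), Matrix.mul_one]
    rw [h3, hDG, Matrix.mul_neg, neg_neg, Matrix.mul_add, Matrix.add_mul, ← Matrix.mul_assoc,
      ← Matrix.mul_assoc, Matrix.nonsing_inv_mul _ (h.isUnit_det hz), Matrix.one_mul,
      Matrix.mul_assoc, Matrix.mul_nonsing_inv _ (h.isUnit_det hz), Matrix.mul_one, add_comm]
  have h4 := congrFun (congrFun hDI a) b
  simp only [DI, Matrix.of_apply, Matrix.add_apply, Matrix.mul_apply, A,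
    Matrix.transpose_apply] at h4
  rw [h4]
  congr 1
  exact Finset.sum_congr rfl fun d _ => mul_comm _ _

/-- Jacobi's formula traces metricity: each of its two terms contributes $-\det
G\,\Gamma_f{}^d{}_d$. -/
theorem pderiv_sqrt (h : IsLeviCivitaOn U G Γ) (hz : z ∈ U) (f : Fin m) :
    pderiv f (fun w => √|(G w).det|) z = -(√|(G z).det| * ∑ d, Γ z (f, d, d)) := by
  have dG := fun a b => differentiableAt_of_contDiffOn h.isOpen (h.smooth_metric a b) hz
  have dD := differentiableAt_of_contDiffOn h.isOpen (contDiffOn_det h.smooth_metric) hz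
  have h0 := h.det_ne_zero z hz
  have hd : pderiv f (fun w => (G w).det) z = -(2 * (G z).det * ∑ d, Γ z (f, d, d)) := by
    rw [pderiv_det dG]
    simp only [h.metricity z hz, mul_neg, Finset.sum_neg_distrib, Finset.mul_sum, mul_add,
      Finset.sum_add_distrib]
    have t1 : ∑ a, ∑ b, ∑ d, (G z).adjugate b a * (Γ z (f, d, a) * G z d b) =
        ∑ d, (G z).det * Γ z (f, d, d) := by
      have : ∀ a d, ∑ b, (G z).adjugate b a * (Γ z (f, d, a) * G z d b) =
          Γ z (f, d, a) * (if d = a then (G z).det else 0) := by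
        intro a d
        have := congrFun (congrFun (Matrix.mul_adjugate (G z)) d) a
        rw [Matrix.mul_apply, Matrix.smul_apply, Matrix.one_apply] at this
        simp only [smul_eq_mul, mul_ite, mul_one, mul_zero] at this
        rw [← this, Finset.mul_sum]
        exact Finset.sum_congr rfl fun b _ => by ring
      rw [Finset.sum_congr rfl fun a _ => Finset.sum_comm]
      simp only [this]
      refine Finset.sum_congr rfl fun a _ => ?_
      simp [mul_comm]
    have t2 : ∑ a, ∑ b, ∑ d, (G z).adjugate b a * (Γ z (f, d, b) * G z a d) =
        ∑ d, (G z).det * Γ z (f, d, d) := by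
      have : ∀ b d, ∑ a, (G z).adjugate b a * (Γ z (f, d, b) * G z a d) =
          Γ z (f, d, b) * (if b = d then (G z).det else 0) := by
        intro b d
        have := congrFun (congrFun (Matrix.adjugate_mul (G z)) b) d
        rw [Matrix.mul_apply, Matrix.smul_apply, Matrix.one_apply] at this
        simp only [smul_eq_mul, mul_ite, mul_one, mul_zero] at this
        rw [← this, Finset.mul_sum]
        exact Finset.sum_congr rfl fun b _ => by ring
      rw [Finset.sum_comm, Finset.sum_congr rfl fun b _ => Finset.sum_comm]
      simp only [this]
      refine Finset.sum_congr rfl fun a _ => ?_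
      simp [mul_comm]
    rw [t1, t2, ← Finset.sum_add_distrib]
    congr 1
    exact Finset.sum_congr rfl fun d _ => by ring
  -- The formula $\sqrt{|t|}/(2t)$ is valid for either sign of $t$, so the signature of the metric
  -- does not matter.
  have hφ : HasDerivAt (fun t : ℝ => √|t|) (√|(G z).det| / (2 * (G z).det)) (G z).det := by
    have h1 := (hasDerivAt_abs h0).sqrt (abs_pos.2 h0).ne'
    convert h1 using 1
    rcases lt_or_gt_of_ne h0 with h2 | h2
    · have : (0 : ℝ) < √|(G z).det| := Real.sqrt_pos.2 (abs_pos.2 h0)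
      have h5 := Real.sq_sqrt (abs_nonneg (G z).det)
      simp only [sign_neg h2, SignType.coe_neg, SignType.coe_one]
      field_simp
      rw [h5, abs_of_neg h2]
    · have : (0 : ℝ) < √|(G z).det| := Real.sqrt_pos.2 (abs_pos.2 h0)
      have h5 := Real.sq_sqrt (abs_nonneg (G z).det)
      simp only [sign_pos h2, SignType.coe_one]
      field_simp
      rw [h5, abs_of_pos h2]
  rw [pderiv_comp hφ dD, hd]
  field_simp

end IsLeviCivitaOn
end

/-- The contravariant derivative `∇^a X^b` in coordinates. -/
noncomputable def contraDeriv {m : ℕ} (G : Vec m → Matrix (Fin m) (Fin m) ℝ)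
    (Γ : Vec m → ConnIdx m → ℝ) (X : Vec m → Vec m) (a b : Fin m) (z : Vec m) : ℝ :=
  ∑ c, (G z)⁻¹ a c * covDeriv Γ X c b z

/-! ### Divergence of the superpotential, symmetries of the curvature, and the coordinate identity.
-/

section

variable {m : ℕ} {U : Set (Vec m)} {G : Vec m → Matrix (Fin m) (Fin m) ℝ}
  {Γ : Vec m → ConnIdx m → ℝ} {X : Vec m → Vec m} {z : Vec m}

theorem riemann_antisymm (q : Jet m (ConnIdx m)) (a b c d : Fin m) :
    riemann q b a c d = -riemann q a b c d := by
  simp only [riemann, Finset.sum_sub_distrib]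
  ring

namespace IsLeviCivitaOn

theorem smooth_contraDeriv (h : IsLeviCivitaOn U G Γ)
    (hX : ∀ b, ContDiffOn ℝ ∞ (fun z => X z b) U) (a b : Fin m) :
    ContDiffOn ℝ ∞ (contraDeriv G Γ X a b) U :=
  ContDiffOn.sum fun c _ =>
    (h.smooth_inv a c).mul (contDiffOn_covDeriv h.isOpen h.smooth_conn hX c b)

/-- Since $g^{-1}$ is parallel, raising an index commutes with $\nabla$; this is
$\nabla_f\nabla^aX^b=g^{ac}\nabla_f\nabla_cX^b$ solved for the partial derivative. -/
theorem pderiv_contraDeriv (h : IsLeviCivitaOn U G Γ)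
    (hX : ∀ b, ContDiffOn ℝ ∞ (fun z => X z b) U) (hz : z ∈ U) (f a b : Fin m) :
    pderiv f (contraDeriv G Γ X a b) z =
      ∑ d, Γ z (f, a, d) * contraDeriv G Γ X d b z +
        ∑ d, Γ z (f, b, d) * contraDeriv G Γ X a d z +
        ∑ c, (G z)⁻¹ a c * covDerivTwo Γ X f c b z := by
  have dI := fun a b => differentiableAt_of_contDiffOn h.isOpen (h.smooth_inv a b) hz
  have dN := fun c b => differentiableAt_of_contDiffOn h.isOpen
    (contDiffOn_covDeriv h.isOpen h.smooth_conn hX c b) hz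
  have hN : ∀ c, pderiv f (covDeriv Γ X c b) z = covDerivTwo Γ X f c b z +
      ∑ e, Γ z (f, b, e) * covDeriv Γ X c e z - ∑ e, Γ z (f, e, c) * covDeriv Γ X e b z :=
    fun c => by rw [covDerivTwo]; ring
  have h1 : pderiv f (contraDeriv G Γ X a b) z = _ :=
    pderiv_sum_mul (fun c => dI a c) (fun c => dN c b) f
  rw [h1]
  simp only [h.pderiv_inv hz, hN, contraDeriv, mul_add, mul_sub, add_mul,
    Finset.sum_add_distrib, Finset.sum_sub_distrib, Finset.mul_sum, Finset.sum_mul]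
  have e1 : ∑ c, ∑ d, Γ z (f, a, d) * (G z)⁻¹ d c * covDeriv Γ X c b z =
      ∑ d, ∑ c, Γ z (f, a, d) * ((G z)⁻¹ d c * covDeriv Γ X c b z) := by
    rw [Finset.sum_comm]
    simp only [mul_assoc]
  have e2 : ∑ c, ∑ e, (G z)⁻¹ a c * (Γ z (f, b, e) * covDeriv Γ X c e z) =
      ∑ d, ∑ c, Γ z (f, b, d) * ((G z)⁻¹ a c * covDeriv Γ X c d z) := by
    rw [Finset.sum_comm]
    simp only [mul_left_comm]
  have e3 : ∑ c, ∑ e, (G z)⁻¹ a c * (Γ z (f, e, c) * covDeriv Γ X e b z) =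
      ∑ c, ∑ d, Γ z (f, c, d) * (G z)⁻¹ a d * covDeriv Γ X c b z := by
    rw [Finset.sum_comm]
    refine Finset.sum_congr rfl fun c _ => Finset.sum_congr rfl fun d _ => by ring
  rw [e1, e2, e3]
  ring

/-- For antisymmetric $F^{ab}$ the divergence needs no connection: the trace term from $\sqrt{|g|}$
cancels the one from the contracted index (`e1`, `e2`), and $\Gamma_a{}^b{}_dF^{ad}$ vanishes
because $\Gamma$ is symmetric (`e3`). -/
theorem divergence_contraDeriv (h : IsLeviCivitaOn U G Γ)
    (hX : ∀ b, ContDiffOn ℝ ∞ (fun z => X z b) U) (hz : z ∈ U) (b : Fin m) :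
    ∑ a, pderiv a (fun w => √|(G w).det| *
        (contraDeriv G Γ X a b w - contraDeriv G Γ X b a w)) z =
      √|(G z).det| * (∑ a, ∑ c, (G z)⁻¹ a c * covDerivTwo Γ X a c b z -
        ∑ a, ∑ c, (G z)⁻¹ b c * covDerivTwo Γ X a c a z) := by
  have dV := fun a b => differentiableAt_of_contDiffOn h.isOpen (h.smooth_contraDeriv hX a b) hz
  have ds := differentiableAt_of_contDiffOn h.isOpen h.smooth_sqrt hz
  have h1 : ∀ a, pderiv a (fun w => √|(G w).det| *
        (contraDeriv G Γ X a b w - contraDeriv G Γ X b a w)) z =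
      -(√|(G z).det| * ∑ d, Γ z (a, d, d)) *
        (contraDeriv G Γ X a b z - contraDeriv G Γ X b a z) +
      √|(G z).det| * (pderiv a (contraDeriv G Γ X a b) z -
        pderiv a (contraDeriv G Γ X b a) z) := by
    intro a
    have := pderiv_mul ds ((dV a b).fun_sub (dV b a)) a
    rw [this, h.pderiv_sqrt hz, pderiv_sub (dV a b) (dV b a)]
  simp only [h1, Finset.sum_add_distrib, h.pderiv_contraDeriv hX hz]
  have e1 : ∑ a, ∑ d, Γ z (a, a, d) * contraDeriv G Γ X d b z =
      ∑ a, (∑ d, Γ z (a, d, d)) * contraDeriv G Γ X a b z := by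
    rw [Finset.sum_comm]
    refine Finset.sum_congr rfl fun d _ => ?_
    rw [Finset.sum_mul]
    exact Finset.sum_congr rfl fun a _ => by rw [h.conn_symm z hz a a d]
  have e2 : ∑ a, ∑ d, Γ z (a, a, d) * contraDeriv G Γ X b d z =
      ∑ a, (∑ d, Γ z (a, d, d)) * contraDeriv G Γ X b a z := by
    rw [Finset.sum_comm]
    refine Finset.sum_congr rfl fun d _ => ?_
    rw [Finset.sum_mul]
    exact Finset.sum_congr rfl fun a _ => by rw [h.conn_symm z hz a a d]
  have e3 : ∑ a, ∑ d, Γ z (a, b, d) * contraDeriv G Γ X d a z =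
      ∑ a, ∑ d, Γ z (a, b, d) * contraDeriv G Γ X a d z := by
    rw [Finset.sum_comm]
    refine Finset.sum_congr rfl fun d _ => Finset.sum_congr rfl fun a _ => ?_
    rw [h.conn_symm z hz]
  have e4 : ∑ a, -(√|(G z).det| * ∑ d, Γ z (a, d, d)) *
        (contraDeriv G Γ X a b z - contraDeriv G Γ X b a z) =
      -(√|(G z).det| * (∑ a, (∑ d, Γ z (a, d, d)) * contraDeriv G Γ X a b z -
        ∑ a, (∑ d, Γ z (a, d, d)) * contraDeriv G Γ X b a z)) := by
    rw [← Finset.sum_sub_distrib, Finset.mul_sum, ← Finset.sum_neg_distrib]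
    exact Finset.sum_congr rfl fun a _ => by ring
  rw [e4, ← Finset.mul_sum]
  simp only [Finset.sum_sub_distrib, Finset.sum_add_distrib, e1, e2, e3]
  ring

/-- The curvature of a metric connection is antisymmetric in its last pair of indices. -/
theorem riemann_metric_antisymm (h : IsLeviCivitaOn U G Γ) (hz : z ∈ U) (e f a b : Fin m) :
    ∑ d, riemann (jetProlong Γ z) e f a d * (G z)⁻¹ d b +
      ∑ d, riemann (jetProlong Γ z) e f b d * (G z)⁻¹ a d = 0 := by
  have dI := fun a b => differentiableAt_of_contDiffOn h.isOpen (h.smooth_inv a b) hz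
  have dΓ := fun i => differentiableAt_of_contDiffOn h.isOpen (h.smooth_conn i) hz
  -- Parallelism of $g^{-1}$ is differentiated once more. Equality of mixed partials of $g^{ab}$ is
  -- then the required antisymmetry, the Ricci identity for $g^{-1}$.
  have key : ∀ e f, pderiv e (pderiv f fun w => (G w)⁻¹ a b) z =
      ∑ d, pderiv e (fun w => Γ w (f, a, d)) z * (G z)⁻¹ d b +
      ∑ d, ∑ k, Γ z (f, a, d) * Γ z (e, d, k) * (G z)⁻¹ k b +
      ∑ d, ∑ k, Γ z (f, a, d) * Γ z (e, b, k) * (G z)⁻¹ d k +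
      (∑ d, pderiv e (fun w => Γ w (f, b, d)) z * (G z)⁻¹ a d +
      ∑ d, ∑ k, Γ z (e, a, d) * Γ z (f, b, k) * (G z)⁻¹ d k +
      ∑ d, ∑ k, Γ z (f, b, d) * Γ z (e, d, k) * (G z)⁻¹ a k) := by
    intro e f
    have h1 : pderiv f (fun w => (G w)⁻¹ a b) =ᶠ[𝓝 z] fun w =>
        ∑ d, Γ w (f, a, d) * (G w)⁻¹ d b + ∑ d, Γ w (f, b, d) * (G w)⁻¹ a d := by
      filter_upwards [h.isOpen.mem_nhds hz] with w hw using h.pderiv_inv hw f a b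
    rw [pderiv_congr h1, pderiv_add
      (DifferentiableAt.fun_sum fun d _ => (dΓ _).fun_mul (dI _ _))
      (DifferentiableAt.fun_sum fun d _ => (dΓ _).fun_mul (dI _ _)),
      pderiv_sum_mul (fun d => dΓ (f, a, d)) (fun d => dI d b),
      pderiv_sum_mul (fun d => dΓ (f, b, d)) (fun d => dI a d)]
    simp only [h.pderiv_inv hz, mul_add, Finset.sum_add_distrib, Finset.mul_sum, mul_assoc]
    have c : ∑ d, ∑ k, Γ z (f, b, d) * (Γ z (e, a, k) * (G z)⁻¹ k d) =
        ∑ d, ∑ k, Γ z (e, a, d) * (Γ z (f, b, k) * (G z)⁻¹ d k) := by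
      rw [Finset.sum_comm]
      exact Finset.sum_congr rfl fun d _ => Finset.sum_congr rfl fun k _ => by ring
    rw [c]
    ring
  have hc := pderiv_comm ((h.smooth_inv a b).contDiffAt (h.isOpen.mem_nhds hz)) f e
  rw [key, key] at hc
  have q : ∀ a (v : Fin m → ℝ), ∑ d, riemann (jetProlong Γ z) e f a d * v d =
      ∑ d, pderiv f (fun w => Γ w (e, a, d)) z * v d -
      ∑ d, pderiv e (fun w => Γ w (f, a, d)) z * v d +
      (∑ d, ∑ k, Γ z (e, a, d) * Γ z (f, d, k) * v k -
      ∑ d, ∑ k, Γ z (f, a, d) * Γ z (e, d, k) * v k) := by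
    intro a v
    simp only [riemann, jetProlong, add_mul, sub_mul, Finset.sum_add_distrib,
      Finset.sum_sub_distrib, Finset.sum_mul]
    rw [Finset.sum_comm (f := fun d k => Γ z (e, a, k) * Γ z (f, k, d) * v d),
      Finset.sum_comm (f := fun d k => Γ z (f, a, k) * Γ z (e, k, d) * v d)]
  rw [q a fun d => (G z)⁻¹ d b, q b fun d => (G z)⁻¹ a d]
  linarith

/-- The first Bianchi identity is bypassed. For symmetric $\Gamma$ the only possibly asymmetric part
of Ricci is $\partial_a\Gamma_d{}^d{}_c$, and $\Gamma_d{}^d{}_c=-\partial_c\log\sqrt{|g|}$ is a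
gradient. -/
theorem ricci_symm (h : IsLeviCivitaOn U G Γ) (hz : z ∈ U) (a c : Fin m) :
    ricci (jetProlong Γ z) a c = ricci (jetProlong Γ z) c a := by
  have ds := differentiableAt_of_contDiffOn h.isOpen h.smooth_sqrt hz
  have dΓ := fun i => differentiableAt_of_contDiffOn h.isOpen (h.smooth_conn i) hz
  have key : ∀ a c, pderiv a (pderiv c fun w => √|(G w).det|) z =
      √|(G z).det| * ((∑ d, Γ z (a, d, d)) * ∑ d, Γ z (c, d, d)) -
      √|(G z).det| * ∑ d, pderiv a (fun w => Γ w (d, d, c)) z := by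
    intro a c
    have h1 : pderiv c (fun w => √|(G w).det|) =ᶠ[𝓝 z] fun w =>
        -(√|(G w).det| * ∑ d, Γ w (d, d, c)) := by
      filter_upwards [h.isOpen.mem_nhds hz] with w hw
      rw [h.pderiv_sqrt hw c]
      congr 2
      exact Finset.sum_congr rfl fun d _ => h.conn_symm w hw _ _ _
    rw [pderiv_congr h1, pderiv_neg, pderiv_mul ds (DifferentiableAt.fun_sum fun d _ => dΓ _),
      h.pderiv_sqrt hz, pderiv_sum fun d _ => dΓ _,
      Finset.sum_congr rfl fun d _ => h.conn_symm z hz d d c]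
    ring
  have hs : √|(G z).det| ≠ 0 := (Real.sqrt_pos.2 (abs_pos.2 (h.det_ne_zero z hz))).ne'
  have hc := pderiv_comm (h.smooth_sqrt.contDiffAt (h.isOpen.mem_nhds hz)) a c
  rw [key, key] at hc
  -- Mixed partials of $\sqrt{|g|}$ agree and the product of traces is symmetric; the nonzero
  -- density can be divided out.
  have hc' : ∑ d, pderiv a (fun w => Γ w (d, d, c)) z =
      ∑ d, pderiv c (fun w => Γ w (d, d, a)) z := by
    apply mul_left_cancel₀ hs
    linarith
  have e1 : ∀ b, pderiv b (fun w => Γ w (a, b, c)) z = pderiv b (fun w => Γ w (c, b, a)) z :=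
    fun b => pderiv_congr (Filter.mem_of_superset (h.isOpen.mem_nhds hz)
      fun w hw => h.conn_symm w hw _ _ _) b
  have e2 : ∑ b, ∑ e, Γ z (a, b, e) * Γ z (b, e, c) =
      ∑ b, ∑ e, Γ z (c, b, e) * Γ z (b, e, a) := by
    rw [Finset.sum_comm]
    refine Finset.sum_congr rfl fun b _ => Finset.sum_congr rfl fun e _ => ?_
    rw [h.conn_symm z hz a e b, h.conn_symm z hz e b c]
    ring
  have e3 : ∀ e, Γ z (a, e, c) = Γ z (c, e, a) := fun e => h.conn_symm z hz _ _ _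
  simp only [ricci, riemann, jetProlong, Finset.sum_add_distrib, Finset.sum_sub_distrib,
    e1, hc', e2, e3]

end IsLeviCivitaOn

/-- The pointwise cancellation of curvature, stated for arrays that have only the needed symmetries.
The array `h` stands for $\nabla_b\nabla_dX^a$ and is arbitrary. -/
theorem sum_momentum_komar_algebra (I : Fin m → Fin m → ℝ) (r : Fin m → Fin m → Fin m → Fin m → ℝ)
    (X : Fin m → ℝ) (hI : ∀ a b, I a b = I b a) (hr : ∀ a b c d, r b a c d = -r a b c d)
    (hm : ∀ e f a b, ∑ d, r e f a d * I d b + ∑ d, r e f b d * I a d = 0)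
    (hric : ∀ a c, ∑ b, r a b b c = ∑ b, r c b b a) (h : Fin m → Fin m → Fin m → ℝ) (a : Fin m) :
    (∑ b, ∑ d, I b d * ∑ k, r b k k d) * X a +
      (∑ b, ∑ d, I b d * (h b d a + ∑ e, X e * r e b a d + ∑ e, r b d a e * X e -
        (∑ k, r b k k d) * X a) -
      ∑ b, ∑ d, I a d * (h b d b + ∑ e, X e * r e b b d + ∑ e, r b d b e * X e -
        (∑ k, r b k k d) * X b)) =
      ∑ b, ∑ d, I b d * h b d a - ∑ b, ∑ d, I a d * h b d b := by
  -- `S` is $g^{ad}R_{ed}X^e$; the contractions `t3` to `t6` all equal $\pm S$ and add up to zero.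
  set S := ∑ d, I a d * ∑ e, X e * ∑ k, r e k k d with hS
  -- The symmetric `I` meets an antisymmetric index pair.
  have t1 : ∑ b, ∑ d, I b d * ∑ e, r b d a e * X e = 0 := by
    have : ∑ b, ∑ d, I b d * ∑ e, r b d a e * X e =
        -∑ b, ∑ d, I b d * ∑ e, r b d a e * X e := by
      conv_lhs => rw [Finset.sum_comm]
      simp only [← Finset.sum_neg_distrib, ← mul_neg]
      refine Finset.sum_congr rfl fun b _ => Finset.sum_congr rfl fun d _ => ?_
      rw [hI]
      congr 1
      exact Finset.sum_congr rfl fun e _ => by rw [hr b d]; ring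
    linarith
  -- The sole use of metricity of the curvature: it exchanges the last two indices, after raising
  -- one, to produce a Ricci contraction.
  have t3 : ∑ b, ∑ d, I b d * ∑ e, X e * r e b a d = -S := by
    have h1 : ∑ b, ∑ d, I b d * ∑ e, X e * r e b a d =
        ∑ e, X e * ∑ b, ∑ d, r e b a d * I d b := by
      simp only [Finset.mul_sum]
      rw [Finset.sum_congr rfl fun b _ => Finset.sum_comm, Finset.sum_comm]
      refine Finset.sum_congr rfl fun e _ => Finset.sum_congr rfl fun b _ =>
        Finset.sum_congr rfl fun d _ => ?_
      rw [hI]; ring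
    have h2 : S = ∑ e, X e * ∑ b, ∑ d, r e b b d * I a d := by
      simp only [hS, Finset.mul_sum]
      rw [Finset.sum_comm]
      refine Finset.sum_congr rfl fun e _ => ?_
      rw [Finset.sum_comm]
      refine Finset.sum_congr rfl fun b _ => Finset.sum_congr rfl fun d _ => by ring
    rw [h1, h2, ← Finset.sum_neg_distrib]
    refine Finset.sum_congr rfl fun e _ => ?_
    rw [← mul_neg, ← Finset.sum_neg_distrib]
    congr 1
    exact Finset.sum_congr rfl fun b _ => eq_neg_of_add_eq_zero_left (hm e b a b)
  have t4 : ∑ b, ∑ d, I a d * ∑ e, X e * r e b b d = S := by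
    rw [hS, Finset.sum_comm]
    refine Finset.sum_congr rfl fun d _ => ?_
    rw [← Finset.mul_sum, Finset.sum_comm]
    simp only [Finset.mul_sum]
  -- The sole use of the symmetry of Ricci: the free index and the index paired with `X` must be
  -- exchanged.
  have t5 : ∑ b, ∑ d, I a d * ∑ e, r b d b e * X e = -S := by
    rw [hS, Finset.sum_comm, ← Finset.sum_neg_distrib]
    refine Finset.sum_congr rfl fun d _ => ?_
    rw [← Finset.mul_sum, ← mul_neg, Finset.sum_comm, ← Finset.sum_neg_distrib]
    congr 1
    refine Finset.sum_congr rfl fun e _ => ?_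
    rw [← Finset.sum_mul, hric e d, ← mul_neg, ← Finset.sum_neg_distrib, mul_comm]
    congr 1
    exact Finset.sum_congr rfl fun b _ => hr _ _ _ _
  have t6 : ∑ b, ∑ d, I a d * ((∑ k, r b k k d) * X b) = S := by
    rw [hS, Finset.sum_comm]
    refine Finset.sum_congr rfl fun d _ => ?_
    rw [← Finset.mul_sum]
    congr 1
    exact Finset.sum_congr rfl fun e _ => mul_comm _ _
  have t2 : ∑ b, ∑ d, I b d * ((∑ k, r b k k d) * X a) =
      (∑ b, ∑ d, I b d * ∑ k, r b k k d) * X a := by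
    simp only [← mul_assoc, ← Finset.sum_mul]
  simp only [mul_add, mul_sub, Finset.sum_add_distrib, Finset.sum_sub_distrib, t1, t2, t3, t4,
    t5, t6]
  ring

/-- The coordinate form of the identity between the Noether and the Komar current. -/
theorem IsLeviCivitaOn.komar_identity (h : IsLeviCivitaOn U G Γ)
    (hX : ∀ b, ContDiffOn ℝ ∞ (fun z => X z b) U) (hz : z ∈ U) (a : Fin m) :
    let q := jetProlong Γ z
    let W := fun b c d => -lieConn X q b c d + ∑ e, riemann q b d c e * X z e -
      ricci q b d * X z c
    (∑ b, ∑ d, (G z)⁻¹ b d * ricci q b d) * √|(G z).det| * X z a +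
      √|(G z).det| * (∑ b, ∑ d, (G z)⁻¹ b d * W b a d - ∑ b, ∑ d, (G z)⁻¹ a d * W b b d) =
    ∑ b, pderiv b (fun w => √|(G w).det| *
        (contraDeriv G Γ X b a w - contraDeriv G Γ X a b w)) z := by
  intro q W
  rw [h.divergence_contraDeriv hX hz, ← sum_momentum_komar_algebra (fun b d => (G z)⁻¹ b d) (riemann q)
    (X z) (h.inv_symm hz) (riemann_antisymm q) (h.riemann_metric_antisymm hz) (h.ricci_symm hz)
    (fun b d a => covDerivTwo Γ X b d a z) a]
  -- The Lie derivative is traded for $\nabla\nabla X$ plus curvature, which puts `W` in the shape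
  -- of the algebraic lemma.
  have hW : ∀ b c d, W b c d = covDerivTwo Γ X b d c z + ∑ e, X z e * riemann q e b c d +
      ∑ e, riemann q b d c e * X z e - (∑ k, riemann q b k k d) * X z c := by
    intro b c d
    simp only [W, q, lieConn_jetProlong h.isOpen h.smooth_conn hX h.conn_symm hz, ricci]
    ring
  simp only [hW, ricci]
  ring

end

/-! ### Exterior products and interior products -/

section Forms

variable {V W : Type*} [NormedAddCommGroup V] [NormedSpace ℝ V] [NormedAddCommGroup W]
  [NormedSpace ℝ W] {k : ℕ}

theorem wedgeOne_apply (α : V →L[ℝ] ℝ) (β : V [⋀^Fin k]→L[ℝ] ℝ) (v : Fin (k + 1) → V) :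
    wedgeOne α β v = ∑ i : Fin (k + 1), (-1 : ℝ) ^ (i : ℕ) * (α (v i) * β (i.removeNth v)) := by
  simp [wedgeOne, ContinuousAlternatingMap.alternatizeUncurryFin_apply]

/-- The antiderivation rule: the $i=0$ term of the alternating sum evaluates $\alpha$ on the
contracted vector, and in the remaining terms that vector stays in the first slot of $\beta$. -/
theorem curryLeft_wedgeOne (α : V →L[ℝ] ℝ) (β : V [⋀^Fin (k + 1)]→L[ℝ] ℝ) (v : V) :
    (wedgeOne α β).curryLeft v = α v • β - wedgeOne α (β.curryLeft v) := by
  ext u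
  have h : ∀ i : Fin (k + 1), i.succ.removeNth (Matrix.vecCons v u : Fin (k + 2) → V) =
      Matrix.vecCons v (i.removeNth u) := by
    intro i
    funext j
    refine Fin.cases ?_ (fun j => ?_) j
    · simp [Fin.removeNth]
    · simp [Fin.removeNth]
  rw [ContinuousAlternatingMap.curryLeft_apply_apply, wedgeOne_apply, Fin.sum_univ_succ,
    ContinuousAlternatingMap.sub_apply, ContinuousAlternatingMap.smul_apply, wedgeOne_apply,
    sub_eq_add_neg, ← Finset.sum_neg_distrib]
  simp only [h, ContinuousAlternatingMap.curryLeft_apply_apply, Fin.val_succ, pow_succ]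
  congr 1
  · have : (0 : Fin (k + 2)).removeNth (Matrix.vecCons v u) = u := by
      funext j
      simp [Fin.removeNth]
    simp [this]
  · refine Finset.sum_congr rfl fun i _ => ?_
    simp

theorem compContinuousLinearMap_wedgeOne (α : W →L[ℝ] ℝ) (β : W [⋀^Fin k]→L[ℝ] ℝ)
    (L : V →L[ℝ] W) :
    (wedgeOne α β).compContinuousLinearMap L =
      wedgeOne (α ∘L L) (β.compContinuousLinearMap L) := by
  ext v
  simp only [ContinuousAlternatingMap.compContinuousLinearMap_apply, wedgeOne_apply]
  rfl

theorem wedgeOne_zero_left (β : V [⋀^Fin k]→L[ℝ] ℝ) : wedgeOne (0 : V →L[ℝ] ℝ) β = 0 := by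
  ext v
  simp [wedgeOne_apply]

theorem curryLeft_compContinuousLinearMap (β : W [⋀^Fin (k + 1)]→L[ℝ] ℝ) (L : V →L[ℝ] W)
    (v : V) :
    (β.compContinuousLinearMap L).curryLeft v = (β.curryLeft (L v)).compContinuousLinearMap L := by
  ext u
  simp only [ContinuousAlternatingMap.curryLeft_apply_apply,
    ContinuousAlternatingMap.compContinuousLinearMap_apply]
  congr 1
  funext j
  refine Fin.cases ?_ (fun j => ?_) j <;> simp

theorem alternatingMap_eq_zero_of_finrank_lt {ι : Type*} [Fintype ι] [FiniteDimensional ℝ V]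
    (h : Module.finrank ℝ V < Fintype.card ι) (η : V [⋀^ι]→L[ℝ] ℝ) : η = 0 := by
  ext v
  refine AlternatingMap.map_linearDependent η.toAlternatingMap v fun hv => ?_
  exact absurd hv.fintype_card_le_finrank (not_le.2 h)

/-- A form of degree $m+1$ on an $m$-dimensional space. Contracting this zero once, then again,
gives the two wedge formulas below without any sign bookkeeping. -/
theorem wedgeOne_coordVol {m : ℕ} (α : Vec m →L[ℝ] ℝ) : wedgeOne α (coordVol m) = 0 :=
  alternatingMap_eq_zero_of_finrank_lt (by simp) _

theorem wedgeOne_dxBar (α : Vec (k + 1) →L[ℝ] ℝ) (b : Fin (k + 1)) :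
    wedgeOne α (dxBar b) = α (basisVec b) • coordVol (k + 1) := by
  have h := curryLeft_wedgeOne α (coordVol (k + 1)) (basisVec b)
  rw [wedgeOne_coordVol] at h
  exact (sub_eq_zero.1 (h.symm.trans (by ext; simp))).symm

theorem wedgeOne_curryLeft_dxBar (α : Vec (k + 2) →L[ℝ] ℝ) (a b : Fin (k + 2)) :
    wedgeOne α ((dxBar b).curryLeft (basisVec a)) =
      α (basisVec a) • dxBar b - α (basisVec b) • dxBar a := by
  have h := curryLeft_wedgeOne α (dxBar b) (basisVec a)
  rw [wedgeOne_dxBar] at h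
  rw [eq_sub_iff_add_eq, ← eq_sub_iff_add_eq']
  rw [← h]
  ext u
  simp [dxBar]

theorem curryLeft_coordVol (v : Vec (k + 1)) :
    (coordVol (k + 1)).curryLeft v = ∑ a, v a • dxBar a := by
  conv_lhs => rw [show v = ∑ a, v a • basisVec a from by
    simpa [basisVec] using ((EuclideanSpace.basisFun (Fin (k + 1)) ℝ).sum_repr v).symm]
  simp [dxBar]

theorem extDeriv_smul_const {f : V → ℝ} {x : V} (hf : DifferentiableAt ℝ f x)
    (η : V [⋀^Fin k]→L[ℝ] ℝ) :
    extDeriv (fun w => f w • η) x = wedgeOne (fderiv ℝ f x) η := by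
  rw [extDeriv, wedgeOne, (hf.hasFDerivAt.smul_const η).fderiv]

theorem extDeriv_fun_sum {ι : Type*} {s : Finset ι} {η : ι → V → V [⋀^Fin k]→L[ℝ] ℝ} {x : V}
    (h : ∀ i ∈ s, DifferentiableAt ℝ (η i) x) :
    extDeriv (fun w => ∑ i ∈ s, η i w) x = ∑ i ∈ s, extDeriv (η i) x := by
  simp only [extDeriv, fderiv_fun_sum h]
  simp only [← ContinuousAlternatingMap.alternatizeUncurryFinCLM_apply, map_sum]

end Forms

/-! ### Pull-back of the Poincaré–Cartan form along a prolonged section -/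

section PoincareCartan

variable {k : ℕ} {ι : Type}

theorem contactForm_apply (i : ι) (p v : Jet (k + 1) ι) :
    contactForm i p v = v.2.1 i - ∑ b, p.2.2 i b * v.1 b := by
  simp [contactForm, dx]

theorem differentiableAt_jetProlong [Fintype ι] {m : ℕ} {φ : Vec m → ι → ℝ} {U : Set (Vec m)}
    (hU : IsOpen U) (hφ : ∀ i, ContDiffOn ℝ ∞ (fun w => φ w i) U) {z : Vec m} (hz : z ∈ U) :
    DifferentiableAt ℝ (jetProlong φ) z := by
  refine differentiableAt_id.prodMk (DifferentiableAt.prodMk ?_ ?_)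
  · exact differentiableAt_pi.2 fun i => differentiableAt_of_contDiffOn hU (hφ i) hz
  · exact differentiableAt_pi.2 fun i => differentiableAt_pi.2 fun a =>
      differentiableAt_of_contDiffOn hU (contDiffOn_pderiv hU (hφ i) a) hz

theorem fst_comp_fderiv_jetProlong [Fintype ι] {m : ℕ} {φ : Vec m → ι → ℝ} {z : Vec m}
    (h : DifferentiableAt ℝ (jetProlong φ) z) :
    ContinuousLinearMap.fst ℝ (Vec m) ((ι → ℝ) × (ι → Fin m → ℝ)) ∘L fderiv ℝ (jetProlong φ) z =
      ContinuousLinearMap.id ℝ (Vec m) :=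
  ((ContinuousLinearMap.fst ℝ (Vec m) ((ι → ℝ) × (ι → Fin m → ℝ))).hasFDerivAt.comp z
    h.hasFDerivAt).unique (hasFDerivAt_id z)

/-- Along a prolonged section $dy^i$ pulls back to $d\varphi^i=\partial_b\varphi^i\,dx^b$, which is
exactly the subtracted part of the contact form. -/
theorem contactForm_comp_fderiv_jetProlong [Fintype ι] {φ : Vec (k + 1) → ι → ℝ} {z : Vec (k + 1)}
    (h : DifferentiableAt ℝ (jetProlong φ) z) (i : ι) :
    contactForm i (jetProlong φ z) ∘L fderiv ℝ (jetProlong φ) z = 0 := by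
  have h1 : fderiv ℝ (fun w => φ w i) z = ContinuousLinearMap.proj (R := ℝ) (φ := fun _ => ℝ) i ∘L
      (ContinuousLinearMap.fst ℝ (ι → ℝ) (ι → Fin (k + 1) → ℝ) ∘L
        ContinuousLinearMap.snd ℝ (Vec (k + 1)) ((ι → ℝ) × (ι → Fin (k + 1) → ℝ))) ∘L
      fderiv ℝ (jetProlong φ) z :=
    ((ContinuousLinearMap.proj (R := ℝ) (φ := fun _ => ℝ) i ∘L
      (ContinuousLinearMap.fst ℝ (ι → ℝ) (ι → Fin (k + 1) → ℝ) ∘L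
        ContinuousLinearMap.snd ℝ (Vec (k + 1)) ((ι → ℝ) × (ι → Fin (k + 1) → ℝ)))).hasFDerivAt.comp
      z h.hasFDerivAt).fderiv
  have h2 := fst_comp_fderiv_jetProlong h
  ext v
  have h3 : (fderiv ℝ (jetProlong φ) z v).1 = v := congrArg (fun L => L v) h2
  have h4 : fderiv ℝ (fun w => φ w i) z v = (fderiv ℝ (jetProlong φ) z v).2.1 i :=
    congrArg (fun L => L v) h1
  rw [ContinuousLinearMap.comp_apply, contactForm_apply, h3, ← h4, fderiv_apply_eq_sum_pderiv]
  simp [jetProlong, mul_comm]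

/-- In $i_Z(\vartheta^i\wedge dx_a)=\vartheta^i(Z)\,dx_a-\vartheta^i\wedge i_Zdx_a$ the second term
pulls back to zero. Thus the jet-direction components of `Z` play no role. -/
theorem pullback_interiorProd_poincareCartan [Fintype ι] [DecidableEq ι] (ℓ : Jet (k + 1) ι → ℝ)
    {φ : Vec (k + 1) → ι → ℝ} {z : Vec (k + 1)} (h : DifferentiableAt ℝ (jetProlong φ) z)
    (Z : Jet (k + 1) ι → Jet (k + 1) ι) :
    pullback (jetProlong φ) (interiorProd Z (poincareCartan ℓ)) z =
      ∑ a, (ℓ (jetProlong φ z) * (Z (jetProlong φ z)).1 a +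
        ∑ i, momentum ℓ i a (jetProlong φ z) *
          contactForm i (jetProlong φ z) (Z (jetProlong φ z))) • dxBar a := by
  set p := jetProlong φ z with hp
  have hf : ∀ {l : ℕ} (β : Vec (k + 1) [⋀^Fin l]→L[ℝ] ℝ), (β.compContinuousLinearMap
      (ContinuousLinearMap.fst ℝ (Vec (k + 1)) ((ι → ℝ) × (ι → Fin (k + 1) → ℝ)))).compContinuousLinearMap
      (fderiv ℝ (jetProlong φ) z) = β := by
    intro l β
    ext v
    simp only [ContinuousAlternatingMap.compContinuousLinearMap_apply]
    congr 1
    funext j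
    exact congrArg (fun L => L (v j)) (fst_comp_fderiv_jetProlong h)
  have hterm : ∀ i a, ((wedgeOne (contactForm i p) ((dxBar a).compContinuousLinearMap
        (ContinuousLinearMap.fst ℝ (Vec (k + 1)) ((ι → ℝ) × (ι → Fin (k + 1) → ℝ))))).curryLeft
        (Z p)).compContinuousLinearMap (fderiv ℝ (jetProlong φ) z) =
      contactForm i p (Z p) • dxBar a := by
    intro i a
    -- On a one-dimensional base $dx_a$ has degree zero and cannot be contracted, so the
    -- antiderivation rule is available only for the successor case.
    cases k with
    | zero =>
      ext v
      simp only [ContinuousAlternatingMap.compContinuousLinearMap_apply,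
        ContinuousAlternatingMap.curryLeft_apply_apply, wedgeOne_apply,
        ContinuousAlternatingMap.smul_apply]
      simp
      left
      congr 1
      funext j
      exact j.elim0
    | succ k =>
      rw [curryLeft_wedgeOne]
      have h1 := compContinuousLinearMap_wedgeOne (contactForm i p)
        (((dxBar a).compContinuousLinearMap (ContinuousLinearMap.fst ℝ (Vec (k + 1 + 1))
          ((ι → ℝ) × (ι → Fin (k + 1 + 1) → ℝ)))).curryLeft (Z p)) (fderiv ℝ (jetProlong φ) z)
      rw [contactForm_comp_fderiv_jetProlong h, wedgeOne_zero_left] at h1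
      have h2 := hf (dxBar a)
      ext v
      have h1' := congrArg (fun η => η v) h1
      have h2' := congrArg (fun η => η v) h2
      simp only [ContinuousAlternatingMap.compContinuousLinearMap_apply,
        ContinuousAlternatingMap.coe_zero, Pi.zero_apply] at h1' h2'
      simp only [ContinuousAlternatingMap.compContinuousLinearMap_apply,
        ContinuousAlternatingMap.sub_apply, ContinuousAlternatingMap.smul_apply, h1', h2', sub_zero]
  have hvol : (((coordVol (k + 1)).compContinuousLinearMap
        (ContinuousLinearMap.fst ℝ (Vec (k + 1)) ((ι → ℝ) × (ι → Fin (k + 1) → ℝ)))).curryLeft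
        (Z p)).compContinuousLinearMap (fderiv ℝ (jetProlong φ) z) = ∑ a, (Z p).1 a • dxBar a := by
    rw [curryLeft_compContinuousLinearMap, hf]
    exact curryLeft_coordVol _
  ext v
  have hterm' := fun i a => congrArg (fun η => η v) (hterm i a)
  have hvol' := congrArg (fun η => η v) hvol
  simp only [ContinuousAlternatingMap.compContinuousLinearMap_apply,
    ContinuousAlternatingMap.curryLeft_apply_apply, ContinuousAlternatingMap.smul_apply,
    ContinuousAlternatingMap.sum_apply, smul_eq_mul] at hterm' hvol'
  simp only [pullback, interiorProd, ← hp, poincareCartan,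
    ContinuousAlternatingMap.compContinuousLinearMap_apply,
    ContinuousAlternatingMap.curryLeft_apply_apply, ContinuousAlternatingMap.add_apply,
    ContinuousAlternatingMap.smul_apply, ContinuousAlternatingMap.sum_apply, smul_eq_mul] at *
  rw [hvol']
  simp only [hterm', add_mul, Finset.sum_add_distrib, Finset.mul_sum, Finset.sum_mul, mul_assoc]
  rw [Finset.sum_comm]

end PoincareCartan

/-! ### The momenta of the gravitational Lagrangian -/

section Momentum

variable {n : ℕ}

theorem momentum_gravLagrangian_metric (i : Fin (n + 1) × Fin (n + 1)) (f : Fin (n + 1))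
    (p : Jet (n + 1) (FieldIdx (n + 1))) : momentum gravLagrangian (Sum.inl i) f p = 0 := by
  have h : ∀ t : ℝ, gravLagrangian (p + t • ((0, 0, Pi.single (Sum.inl i) (Pi.single f 1)) :
      Jet (n + 1) (FieldIdx (n + 1)))) = gravLagrangian p := by
    intro t
    simp [gravLagrangian, Jet.metric, Jet.conn, ricci, riemann]
  rw [momentum, lineDeriv]
  simp only [h]
  simp

/-- The curvature is affine in the derivative coordinates, so along a coordinate line the Lagrangian
is exactly affine in `t` and the momentum is its slope `K`. -/
theorem momentum_gravLagrangian_conn (b c d f : Fin (n + 1))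
    (p : Jet (n + 1) (FieldIdx (n + 1))) :
    momentum gravLagrangian (Sum.inr (b, c, d)) f p =
      ((if c = f then p.metric⁻¹ b d else 0) - if b = c then p.metric⁻¹ f d else 0) *
        √|p.metric.det| := by
  set K : ℝ := ((if c = f then p.metric⁻¹ b d else 0) - if b = c then p.metric⁻¹ f d else 0) *
        √|p.metric.det|
  have h : ∀ t : ℝ, gravLagrangian (p + t • ((0, 0, Pi.single (Sum.inr (b, c, d))
      (Pi.single f 1)) : Jet (n + 1) (FieldIdx (n + 1)))) = gravLagrangian p + t * K := by
    intro t
    set v : Jet (n + 1) (FieldIdx (n + 1)) := (0, 0, Pi.single (Sum.inr (b, c, d))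
      (Pi.single f 1)) with hv
    have hm : (p + t • v).metric = p.metric := by
      ext
      simp [Jet.metric, hv]
    have hr : ∀ A C, ricci (p + t • v).conn A C = ricci p.conn A C +
        t * ∑ B, (v.conn.2.2 (A, B, C) B - v.conn.2.2 (B, B, C) A) := by
      intro A C
      rw [ricci, ricci, Finset.mul_sum, ← Finset.sum_add_distrib]
      refine Finset.sum_congr rfl fun B _ => ?_
      simp only [riemann, Jet.conn, hv, Prod.snd_add, Prod.fst_add, Prod.smul_snd, Prod.smul_fst,
        Pi.add_apply, Pi.smul_apply, smul_eq_mul, Pi.zero_apply, mul_zero, add_zero]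
      ring
    have hs : ∀ i a, v.conn.2.2 i a = if i = (b, c, d) then (if a = f then 1 else 0) else 0 := by
      intro i a
      simp only [Jet.conn, hv, Pi.single_apply, Sum.inr.injEq]
      split_ifs <;> simp_all
    have h1 : ∑ A, ∑ C, p.metric⁻¹ A C * ∑ B, v.conn.2.2 (A, B, C) B =
        if c = f then p.metric⁻¹ b d else 0 := by
      simp [hs, Prod.ext_iff, ite_and]
    have h2 : ∑ A, ∑ C, p.metric⁻¹ A C * ∑ B, v.conn.2.2 (B, B, C) A =
        if b = c then p.metric⁻¹ f d else 0 := by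
      simp [hs, Prod.ext_iff, ite_and]
    rw [gravLagrangian, gravLagrangian, hm]
    simp only [hr, mul_add, Finset.sum_add_distrib, Finset.sum_sub_distrib, mul_sub, add_mul,
      mul_left_comm _ t, ← Finset.mul_sum, h1, h2]
    simp only [K]
    ring
  rw [momentum, lineDeriv]
  simp only [h]
  simp

theorem sum_conn_momentum {m : ℕ} (I : Fin m → Fin m → ℝ) (W : Fin m → Fin m → Fin m → ℝ) (s : ℝ)
    (a : Fin m) :
    ∑ b, ∑ c, ∑ d, ((if c = a then I b d else 0) - if b = c then I a d else 0) * s * W b c d =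
      s * (∑ b, ∑ d, I b d * W b a d - ∑ b, ∑ d, I a d * W b b d) := by
  have h1 : ∑ b, ∑ c, ∑ d, (if c = a then I b d else 0) * W b c d = ∑ b, ∑ d, I b d * W b a d := by
    refine Finset.sum_congr rfl fun b _ => ?_
    rw [Finset.sum_eq_single a (fun c _ hc => by simp [hc]) (by simp)]
    simp
  have h2 : ∑ b, ∑ c, ∑ d, (if b = c then I a d else 0) * W b c d =
      ∑ b, ∑ d, I a d * W b b d := by
    refine Finset.sum_congr rfl fun b _ => ?_
    rw [Finset.sum_eq_single b (fun c _ hc => by simp [hc.symm]) (by simp)]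
    simp
  rw [← h1, ← h2]
  simp only [← Finset.sum_sub_distrib, Finset.mul_sum]
  refine Finset.sum_congr rfl fun b _ => Finset.sum_congr rfl fun c _ =>
    Finset.sum_congr rfl fun d _ => by ring

end Momentum

/-! ### The Komar current in coordinates -/

section Current

variable {n : ℕ} {U : Set (Vec (n + 2))} {G : Vec (n + 2) → Matrix (Fin (n + 2)) (Fin (n + 2)) ℝ}
  {Γ : Vec (n + 2) → ConnIdx (n + 2) → ℝ} {X : Vec (n + 2) → Vec (n + 2)} {z : Vec (n + 2)}

theorem extDeriv_flatForm_apply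
    (h : ∀ a, DifferentiableAt ℝ (fun w => ∑ c, G w a c * X w c) z) (c d : Fin (n + 2)) :
    extDeriv (flatForm G X) z ![basisVec c, basisVec d] =
      pderiv c (fun w => ∑ e, G w d e * X w e) z - pderiv d (fun w => ∑ e, G w c e * X w e) z := by
  have hd : DifferentiableAt ℝ (flatForm G X) z := by
    have h1 : DifferentiableAt ℝ (fun w => ∑ a, (∑ c, G w a c * X w c) • dx a) z :=
      DifferentiableAt.fun_sum fun a _ => (h a).smul_const _
    exact ((ContinuousAlternatingMap.ofSubsingletonLIE (𝕜 := ℝ) (E := Vec (n + 2)) (F := ℝ)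
      (0 : Fin 1)).differentiableAt
      (x := ∑ a, (∑ c, G z a c * X z c) • dx a)).comp z h1
  have hv : ∀ (b : Fin (n + 2)) (v : Fin 1 → Vec (n + 2)), v 0 = basisVec b →
      (fun w => flatForm G X w v) = fun w => ∑ e, G w b e * X w e := by
    intro b v hv
    funext w
    simp [flatForm, hv, dx, basisVec, PiLp.single_apply]
  rw [extDeriv_apply hd, Fin.sum_univ_two, hv d _ rfl, hv c _ rfl]
  simp [pderiv, sub_eq_add_neg]

namespace IsLeviCivitaOn

/-- Metricity replaces partial derivatives by covariant ones, and the leftover connection terms are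
symmetric in the two indices, hence drop out of the exterior derivative. -/
theorem extDeriv_flatForm (h : IsLeviCivitaOn U G Γ)
    (hX : ∀ b, ContDiffOn ℝ ∞ (fun z => X z b) U) (hz : z ∈ U) (c d : Fin (n + 2)) :
    extDeriv (flatForm G X) z ![basisVec c, basisVec d] =
      ∑ e, G z d e * covDeriv Γ X c e z - ∑ e, G z c e * covDeriv Γ X d e z := by
  have dG := fun a b => differentiableAt_of_contDiffOn h.isOpen (h.smooth_metric a b) hz
  have dX := fun b => differentiableAt_of_contDiffOn h.isOpen (hX b) hz
  have key : ∀ c d, pderiv c (fun w => ∑ e, G w d e * X w e) z =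
      ∑ e, G z d e * covDeriv Γ X c e z - ∑ e, ∑ k, Γ z (c, k, d) * G z k e * X z e := by
    intro c d
    rw [pderiv_sum_mul (fun e => dG d e) dX]
    simp only [h.metricity z hz, covDeriv, mul_sub, Finset.sum_sub_distrib, Finset.sum_add_distrib,
      neg_mul, add_mul, Finset.sum_mul, Finset.mul_sum, Finset.sum_neg_distrib]
    have : ∑ e, ∑ k, Γ z (c, k, e) * G z d k * X z e =
        ∑ e, ∑ k, G z d e * (Γ z (c, e, k) * X z k) := by
      rw [Finset.sum_comm]
      exact Finset.sum_congr rfl fun e _ => Finset.sum_congr rfl fun k _ => by ring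
    rw [this]
    ring
  rw [extDeriv_flatForm_apply fun a => DifferentiableAt.fun_sum fun c _ => (dG a c).fun_mul (dX c),
    key, key]
  simp only [h.conn_symm z hz c _ d]
  ring

/-- Raising both indices of $d(g^\flat X)$ leaves one inverse metric in each term, since the other
contracts with $g$ to a Kronecker delta. -/
theorem hodgeTwo_coeff (h : IsLeviCivitaOn U G Γ)
    (hX : ∀ b, ContDiffOn ℝ ∞ (fun z => X z b) U) (hz : z ∈ U) (a b : Fin (n + 2)) :
    ∑ c, ∑ d, (G z)⁻¹ a c * (G z)⁻¹ b d *
        extDeriv (flatForm G X) z ![basisVec c, basisVec d] =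
      contraDeriv G Γ X a b z - contraDeriv G Γ X b a z := by
  have hI : ∀ a e, ∑ d, (G z)⁻¹ a d * G z d e = if a = e then 1 else 0 := by
    intro a e
    rw [← Matrix.mul_apply, Matrix.nonsing_inv_mul _ (h.isUnit_det hz), Matrix.one_apply]
  simp only [h.extDeriv_flatForm hX hz, mul_sub, Finset.sum_sub_distrib, contraDeriv]
  have e1 : ∑ c, ∑ d, (G z)⁻¹ a c * (G z)⁻¹ b d * ∑ e, G z d e * covDeriv Γ X c e z =
      ∑ c, (G z)⁻¹ a c * covDeriv Γ X c b z := by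
    refine Finset.sum_congr rfl fun c _ => ?_
    have : ∑ d, (G z)⁻¹ a c * (G z)⁻¹ b d * ∑ e, G z d e * covDeriv Γ X c e z =
        (G z)⁻¹ a c * ∑ e, (∑ d, (G z)⁻¹ b d * G z d e) * covDeriv Γ X c e z := by
      simp only [Finset.mul_sum, Finset.sum_mul]
      rw [Finset.sum_comm]
      exact Finset.sum_congr rfl fun e _ => Finset.sum_congr rfl fun d _ => by ring
    rw [this]
    simp [hI]
  have e2 : ∑ c, ∑ d, (G z)⁻¹ a c * (G z)⁻¹ b d * ∑ e, G z c e * covDeriv Γ X d e z =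
      ∑ c, (G z)⁻¹ b c * covDeriv Γ X c a z := by
    rw [Finset.sum_comm]
    refine Finset.sum_congr rfl fun c _ => ?_
    have : ∑ d, (G z)⁻¹ a d * (G z)⁻¹ b c * ∑ e, G z d e * covDeriv Γ X c e z =
        (G z)⁻¹ b c * ∑ e, (∑ d, (G z)⁻¹ a d * G z d e) * covDeriv Γ X c e z := by
      simp only [Finset.mul_sum, Finset.sum_mul]
      rw [Finset.sum_comm]
      exact Finset.sum_congr rfl fun e _ => Finset.sum_congr rfl fun d _ => by ring
    rw [this]
    simp [hI]
  rw [e1, e2]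

/-- With $F^{ab}$ antisymmetric,
$d(F^{ab}i_{\partial_a}i_{\partial_b}d^mx)=\partial_aF^{ab}dx_b-\partial_bF^{ab}dx_a$ consists of
two equal halves; the factor $\tfrac12$ in the current absorbs the doubling. -/
theorem komarCurrent_eq (h : IsLeviCivitaOn U G Γ)
    (hX : ∀ b, ContDiffOn ℝ ∞ (fun z => X z b) U) (hz : z ∈ U) :
    komarCurrent G X z = ∑ a, (∑ b, pderiv b (fun w => √|(G w).det| *
        (contraDeriv G Γ X b a w - contraDeriv G Γ X a b w)) z) • dxBar a := by
  let F : Fin (n + 2) → Fin (n + 2) → Vec (n + 2) → ℝ := fun a b w => √|(G w).det| *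
        (contraDeriv G Γ X a b w - contraDeriv G Γ X b a w)
  have dF : ∀ a b, DifferentiableAt ℝ (F a b) z := fun a b =>
    differentiableAt_of_contDiffOn h.isOpen (h.smooth_sqrt.mul
      ((h.smooth_contraDeriv hX a b).sub (h.smooth_contraDeriv hX b a))) hz
  have hF : ∀ a b, F b a = fun w => -F a b w := by
    intro a b
    funext w
    simp only [F]
    ring
  have h1 : (fun w => hodgeTwo (G w) (extDeriv (flatForm G X) w)) =ᶠ[𝓝 z]
      fun w => ∑ a, ∑ b, F a b w • (dxBar b).curryLeft (basisVec a) := by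
    filter_upwards [h.isOpen.mem_nhds hz] with w hw
    simp only [hodgeTwo, h.hodgeTwo_coeff hX hw, F]
    refine Finset.sum_congr rfl fun a _ => Finset.sum_congr rfl fun b _ => ?_
    rw [mul_comm]
  rw [komarCurrent, h1.extDeriv_eq, extDeriv_fun_sum fun a _ =>
    DifferentiableAt.fun_sum fun b _ => (dF a b).smul_const _]
  have h2 : ∀ a, extDeriv (fun w => ∑ b, F a b w • (dxBar b).curryLeft (basisVec a)) z =
      ∑ b, (pderiv a (F a b) z • dxBar b - pderiv b (F a b) z • dxBar a) := by
    intro a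
    rw [extDeriv_fun_sum fun b _ => (dF a b).smul_const _]
    refine Finset.sum_congr rfl fun b _ => ?_
    rw [extDeriv_smul_const (dF a b), wedgeOne_curryLeft_dxBar]
    rfl
  have h3 : ∑ a, ∑ b, pderiv b (F a b) z • dxBar a =
      -∑ a, ∑ b, pderiv b (F b a) z • (dxBar a : Vec (n + 2) [⋀^Fin (n + 1)]→L[ℝ] ℝ) := by
    rw [← Finset.sum_neg_distrib]
    refine Finset.sum_congr rfl fun a _ => ?_
    rw [← Finset.sum_neg_distrib]
    refine Finset.sum_congr rfl fun b _ => ?_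
    rw [hF a b, pderiv_neg]
    ext v
    simp
  have h4 : ∑ a, ∑ b, pderiv a (F a b) z • dxBar b =
      ∑ a, ∑ b, pderiv b (F b a) z • (dxBar a : Vec (n + 2) [⋀^Fin (n + 1)]→L[ℝ] ℝ) :=
    Finset.sum_comm
  simp only [h2, Finset.sum_sub_distrib, h3, h4, sub_neg_eq_add, Finset.sum_smul]
  rw [← two_smul ℝ, smul_smul]
  norm_num
  rfl

theorem pullback_poincareCartan_eq_komarCurrent (h : IsLeviCivitaOn U G Γ)
    (hX : ∀ b, ContDiffOn ℝ ∞ (fun z => X z b) U)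
    (Z : Jet (n + 2) (FieldIdx (n + 2)) → Jet (n + 2) (FieldIdx (n + 2)))
    (hZ : ∀ p, p.1 ∈ U → ((Z p).1, fun i => (Z p).2.1 (Sum.inr i)) = komarLift X p.conn)
    (hz : z ∈ U) :
    pullback (jetProlong fun w => (Sum.elim (fun i => G w i.1 i.2) (Γ w) : FieldIdx (n + 2) → ℝ))
      (interiorProd Z (poincareCartan gravLagrangian)) z = komarCurrent G X z := by
  set φ : Vec (n + 2) → FieldIdx (n + 2) → ℝ := fun w => Sum.elim (fun i => G w i.1 i.2) (Γ w)
    with hφ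
  have hφs : ∀ i, ContDiffOn ℝ ∞ (fun w => φ w i) U := by
    rintro (i | i)
    · exact h.smooth_metric i.1 i.2
    · exact h.smooth_conn i
  rw [pullback_interiorProd_poincareCartan _ (differentiableAt_jetProlong h.isOpen hφs hz),
    h.komarCurrent_eq hX hz]
  refine Finset.sum_congr rfl fun a _ => ?_
  congr 1
  rw [← h.komar_identity hX hz a]
  set p := jetProlong φ z with hp
  have hm : p.metric = G z := rfl
  have hc : p.conn = jetProlong Γ z := rfl
  have hZp := hZ p hz
  rw [hc] at hZp
  have hZ1 : (Z p).1 = X z := congrArg Prod.fst hZp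
  have hZ2 : ∀ i, (Z p).2.1 (Sum.inr i) = _ := fun i => congrFun (congrArg Prod.snd hZp) i
  -- The contact form subtracts $X^e\partial_e\Gamma_b{}^c{}_d$, precisely the non-tensorial part of
  -- `komarLift`.
  have hθ : ∀ b c d, contactForm (Sum.inr (b, c, d)) p (Z p) =
      -lieConn X (jetProlong Γ z) b c d + ∑ e, riemann (jetProlong Γ z) b d c e * X z e -
        ricci (jetProlong Γ z) b d * X z c := by
    intro b c d
    rw [contactForm_apply, hZ2, hZ1]
    have : ∑ e, X z e * (jetProlong Γ z).2.2 (b, c, d) e =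
        ∑ e, p.2.2 (Sum.inr (b, c, d)) e * X z e :=
      Finset.sum_congr rfl fun e _ => mul_comm _ _
    change ∑ e, X z e * (jetProlong Γ z).2.2 (b, c, d) e - _ + _ - _ - _ = _
    rw [this]
    simp only [jetProlong]
    ring
  have hℓ : gravLagrangian p = (∑ b, ∑ d, (G z)⁻¹ b d * ricci (jetProlong Γ z) b d) *
      √|(G z).det| := rfl
  rw [hℓ, hZ1, Fintype.sum_sum_type]
  simp only [momentum_gravLagrangian_metric, zero_mul, Finset.sum_const_zero, zero_add]
  congr 1
  rw [Fintype.sum_prod_type]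
  simp only [Fintype.sum_prod_type, momentum_gravLagrangian_conn, hm, hθ]
  exact sum_conn_momentum (fun b d => (G z)⁻¹ b d) (fun b c d => -lieConn X (jetProlong Γ z) b c d +
    ∑ e, riemann (jetProlong Γ z) b d c e * X z e - ricci (jetProlong Γ z) b d * X z c) _ a

end IsLeviCivitaOn

end Current

section Manifold

variable {m : ℕ} {M : Type*} [TopologicalSpace M] [ChartedSpace (Vec m) M]
  {e : OpenPartialHomeomorph M (Vec m)}

/-! ### Components in a chart -/

theorem mdifferentiable_of_mem_maximalAtlas (he : e ∈ IsManifold.maximalAtlas (𝓡 m) ∞ M) :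
    e.MDifferentiable (𝓡 m) (𝓡 m) :=
  ⟨(contMDiffOn_of_mem_maximalAtlas he).mdifferentiableOn (by simp),
    (contMDiffOn_symm_of_mem_maximalAtlas he).mdifferentiableOn (by simp)⟩

theorem isInvertible_mfderiv_chart (he : e ∈ IsManifold.maximalAtlas (𝓡 m) ∞ M) {x : M}
    (hx : x ∈ e.source) : (mfderiv (𝓡 m) (𝓡 m) e x).IsInvertible :=
  ⟨(mdifferentiable_of_mem_maximalAtlas he).mfderiv hx, rfl⟩

theorem isInvertible_mfderiv_chart_symm (he : e ∈ IsManifold.maximalAtlas (𝓡 m) ∞ M) {z : Vec m}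
    (hz : z ∈ e.target) : (mfderiv (𝓡 m) (𝓡 m) e.symm z).IsInvertible :=
  ⟨(mdifferentiable_of_mem_maximalAtlas he).symm.mfderiv hz, rfl⟩

theorem components_coordField (he : e ∈ IsManifold.maximalAtlas (𝓡 m) ∞ M) {x : M}
    (hx : x ∈ e.source) (a : Fin m) : components e x (coordField e a x) = basisVec a :=
  (isInvertible_mfderiv_chart he hx).self_apply_inverse _

theorem components_injective (he : e ∈ IsManifold.maximalAtlas (𝓡 m) ∞ M) {x : M}
    (hx : x ∈ e.source) {v w : TangentSpace (𝓡 m) x} (h : components e x v = components e x w) :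
    v = w :=
  (mdifferentiable_of_mem_maximalAtlas he).mfderiv_injective hx h

theorem components_sum {x : M} {ι : Type*} (s : Finset ι) (c : ι → ℝ)
    (v : ι → TangentSpace (𝓡 m) x) :
    components e x (∑ i ∈ s, c i • v i) = ∑ i ∈ s, c i • components e x (v i) := by
  simp only [components, map_sum, map_smul]
  rfl

theorem eq_sum_components (he : e ∈ IsManifold.maximalAtlas (𝓡 m) ∞ M) {x : M}
    (hx : x ∈ e.source) (v : TangentSpace (𝓡 m) x) :
    v = ∑ a, components e x v a • coordField e a x := by
  refine components_injective he hx ?_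
  rw [components_sum]
  simp only [components_coordField he hx]
  simpa [basisVec] using ((EuclideanSpace.basisFun (Fin m) ℝ).sum_repr (components e x v)).symm

theorem vectorCoord_apply {W : Π y : M, TangentSpace (𝓡 m) y} {x : M} (hx : x ∈ e.source) :
    vectorCoord e W (e x) = components e x (W x) := by
  rw [vectorCoord, e.left_inv hx]

/-- The coordinate expression is the pullback by the inverse chart, so smoothness of pullbacks and
naturality of the Lie bracket become applicable to it. -/
theorem vectorCoord_eq_mpullback (he : e ∈ IsManifold.maximalAtlas (𝓡 m) ∞ M)
    (W : Π y : M, TangentSpace (𝓡 m) y) {z : Vec m} (hz : z ∈ e.target) :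
    vectorCoord e W z = VectorField.mpullback (𝓡 m) (𝓡 m) e.symm W z := by
  have h1 := (mdifferentiable_of_mem_maximalAtlas he).comp_symm_deriv hz
  have h2 := isInvertible_mfderiv_chart_symm he hz
  rw [VectorField.mpullback_apply]
  have h3 := h2.self_apply_inverse (W (e.symm z))
  have h4 := congrArg (fun L => L ((mfderiv (𝓡 m) (𝓡 m) e.symm z).inverse (W (e.symm z)))) h1
  simp only [ContinuousLinearMap.comp_apply, h3] at h4
  exact h4

theorem vectorCoord_coordField (he : e ∈ IsManifold.maximalAtlas (𝓡 m) ∞ M) {z : Vec m}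
    (hz : z ∈ e.target) (a : Fin m) : vectorCoord e (coordField e a) z = basisVec a :=
  components_coordField he (e.map_target hz) a

theorem mvfderiv_eq_fderiv_comp_symm (he : e ∈ IsManifold.maximalAtlas (𝓡 m) ∞ M) {F : M → ℝ}
    {x : M} (hx : x ∈ e.source) (hF : DifferentiableAt ℝ (F ∘ e.symm) (e x))
    (u : TangentSpace (𝓡 m) x) :
    MDifferentiableAt (𝓡 m) 𝓘(ℝ, ℝ) F x ∧
      mvfderiv (𝓡 m) F x u = fderiv ℝ (F ∘ e.symm) (e x) (components e x u) := by
  have h1 : HasMFDerivAt (𝓡 m) 𝓘(ℝ, ℝ) ((F ∘ e.symm) ∘ e) x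
      ((fderiv ℝ (F ∘ e.symm) (e x)).comp (mfderiv (𝓡 m) (𝓡 m) e x)) :=
    HasMFDerivAt.comp x (hF.hasFDerivAt.hasMFDerivAt)
      ((mdifferentiable_of_mem_maximalAtlas he).mdifferentiableAt hx).hasMFDerivAt
  have h2 : F =ᶠ[𝓝 x] (F ∘ e.symm) ∘ e := by
    filter_upwards [e.open_source.mem_nhds hx] with y hy
    simp [e.left_inv hy]
  have h3 := h1.congr_of_eventuallyEq h2
  refine ⟨h3.mdifferentiableAt, ?_⟩
  rw [mvfderiv, ContinuousLinearMap.comp_apply, h3.mfderiv]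
  rfl

variable [IsManifold (𝓡 m) ∞ M]

/-- A vector field as a map into the total space of the tangent bundle. -/
abbrev toBundle (W : Π y : M, TangentSpace (𝓡 m) y) (y : M) : TangentBundle (𝓡 m) M := ⟨y, W y⟩

/-- Smoothness of a vector field on a set. -/
abbrev SmoothFieldOn (W : Π y : M, TangentSpace (𝓡 m) y) (s : Set M) : Prop :=
  ContMDiffOn (𝓡 m) (𝓡 m).tangent ∞ (toBundle W) s

theorem contMDiffOn_coordField (he : e ∈ IsManifold.maximalAtlas (𝓡 m) ∞ M) (a : Fin m) :
    SmoothFieldOn (coordField e a) e.source := by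
  intro x hx
  refine ContMDiffAt.contMDiffWithinAt ?_
  refine ContMDiffAt.mpullback_vectorField_preimage (V := fun _ => basisVec a) (n := ∞) ?_
    (contMDiffAt_of_mem_maximalAtlas he hx) (isInvertible_mfderiv_chart he hx) (by simp)
  exact contMDiffAt_vectorSpace_iff_contDiffAt.2 contDiffAt_const

theorem contDiffAt_vectorCoord (he : e ∈ IsManifold.maximalAtlas (𝓡 m) ∞ M)
    {W : Π y : M, TangentSpace (𝓡 m) y} {z : Vec m} (hz : z ∈ e.target)
    (hW : ContMDiffAt (𝓡 m) (𝓡 m).tangent ∞ (toBundle W) (e.symm z)) :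
    ContDiffAt ℝ ∞ (vectorCoord e W) z := by
  have h1 : ContDiffAt ℝ ∞ (VectorField.mpullback (𝓡 m) (𝓡 m) e.symm W) z :=
    contMDiffAt_vectorSpace_iff_contDiffAt.1
      (hW.mpullback_vectorField_preimage (n := ∞) (contMDiffAt_symm_of_mem_maximalAtlas he hz)
        (isInvertible_mfderiv_chart_symm he hz) (by simp))
  refine h1.congr_of_eventuallyEq ?_
  filter_upwards [e.open_target.mem_nhds hz] with w hw using vectorCoord_eq_mpullback he W hw

theorem contDiffOn_vectorCoord (he : e ∈ IsManifold.maximalAtlas (𝓡 m) ∞ M)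
    {W : Π y : M, TangentSpace (𝓡 m) y} (hW : SmoothFieldOn W e.source) (b : Fin m) :
    ContDiffOn ℝ ∞ (fun z => vectorCoord e W z b) e.target := by
  intro z hz
  refine ContDiffAt.contDiffWithinAt ?_
  have h1 := contDiffAt_vectorCoord he hz
    (hW.contMDiffAt (e.open_source.mem_nhds (e.map_target hz)))
  exact (EuclideanSpace.proj (𝕜 := ℝ) b).contDiff.contDiffAt.comp z h1

theorem components_mlieBracket (he : e ∈ IsManifold.maximalAtlas (𝓡 m) ∞ M)
    {V W : Π y : M, TangentSpace (𝓡 m) y} (hV : SmoothFieldOn V e.source)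
    (hW : SmoothFieldOn W e.source) {z : Vec m} (hz : z ∈ e.target) (c : Fin m) :
    vectorCoord e (VectorField.mlieBracket (𝓡 m) V W) z c =
      ∑ a, (vectorCoord e V z a * pderiv a (fun w => vectorCoord e W w c) z -
        vectorCoord e W z a * pderiv a (fun w => vectorCoord e V w c) z) := by
  have : IsManifold (𝓡 m) (minSmoothness ℝ 3) M :=
    IsManifold.of_le (n := ∞) (by simp; decide)
  have hs := e.open_source.mem_nhds (e.map_target hz)
  have h1 := VectorField.mpullback_mlieBracket (I := 𝓡 m) (I' := 𝓡 m) (n := ∞)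
    ((hV.contMDiffAt hs).mdifferentiableAt (by simp))
    ((hW.contMDiffAt hs).mdifferentiableAt (by simp))
    (contMDiffAt_symm_of_mem_maximalAtlas he hz) (by simp; decide)
  have hVe : VectorField.mpullback (𝓡 m) (𝓡 m) e.symm V =ᶠ[𝓝 z] vectorCoord e V := by
    filter_upwards [e.open_target.mem_nhds hz] with w hw using (vectorCoord_eq_mpullback he V hw).symm
  have hWe : VectorField.mpullback (𝓡 m) (𝓡 m) e.symm W =ᶠ[𝓝 z] vectorCoord e W := by
    filter_upwards [e.open_target.mem_nhds hz] with w hw using (vectorCoord_eq_mpullback he W hw).symm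
  have hb : ∀ A B : Π w : Vec m, TangentSpace (𝓡 m) w, VectorField.mlieBracket (𝓡 m) A B z =
      VectorField.lieBracket ℝ A B z := by
    intro A B
    rw [← VectorField.mlieBracketWithin_univ]
    exact (congrFun VectorField.mlieBracketWithin_eq_lieBracketWithin z).trans
      (congrFun VectorField.lieBracketWithin_univ z)
  rw [vectorCoord_eq_mpullback he _ hz, h1, hVe.mlieBracket_vectorField_eq hWe]
  refine (congrArg (fun v : Vec m => v c) (hb _ _)).trans ?_
  rw [VectorField.lieBracket]
  have hd : ∀ {W : Π y : M, TangentSpace (𝓡 m) y}, SmoothFieldOn W e.source →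
      ∀ v, fderiv ℝ (vectorCoord e W) z v c =
        ∑ a, v a * pderiv a (fun w => vectorCoord e W w c) z := by
    intro W hW v
    have h2 : DifferentiableAt ℝ (vectorCoord e W) z :=
      (contDiffAt_vectorCoord he hz (hW.contMDiffAt hs)).differentiableAt (by simp)
    have h3 : HasFDerivAt (fun w => vectorCoord e W w c)
        ((EuclideanSpace.proj (𝕜 := ℝ) c).comp (fderiv ℝ (vectorCoord e W) z)) z :=
      (EuclideanSpace.proj (𝕜 := ℝ) c).hasFDerivAt.comp z h2.hasFDerivAt
    rw [← fderiv_apply_eq_sum_pderiv, h3.fderiv]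
    rfl
  rw [Finset.sum_sub_distrib, ← hd hW, ← hd hV]
  rfl

/-! ### Covariant derivatives in a chart -/

theorem cov_sum (cov : LinearConnection m M) {ι : Type*} (s : Finset ι)
    (σ : ι → Π y : M, TangentSpace (𝓡 m) y) {x : M}
    (hσ : ∀ i ∈ s, MDifferentiableAt (𝓡 m) (𝓡 m).tangent (toBundle (σ i)) x) :
    cov (fun y => ∑ i ∈ s, σ i y) x = ∑ i ∈ s, cov (σ i) x := by
  classical
  induction s using Finset.induction_on with
  | empty =>
    simp only [Finset.sum_empty]
    exact congrFun cov.zero x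
  | insert i s hi ih =>
    have h1 : MDifferentiableAt (𝓡 m) (𝓡 m).tangent (toBundle (fun y => ∑ i ∈ s, σ i y)) x :=
      MDifferentiableAt.sum_section fun j hj => hσ j (Finset.mem_insert_of_mem hj)
    simp only [Finset.sum_insert hi]
    rw [← ih fun j hj => hσ j (Finset.mem_insert_of_mem hj)]
    exact cov.isCovariantDerivativeOnUniv.add (hσ i (Finset.mem_insert_self _ _)) h1

theorem connCoord_apply (cov : LinearConnection m M) {x : M} (hx : x ∈ e.source) (a b c : Fin m) :
    connCoord e cov (e x) (a, b, c) =
      -components e x (cov (coordField e c) x (coordField e a x)) b := by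
  simp only [connCoord]
  rw [e.left_inv hx]

/-- Near the point, $W$ is a combination of coordinate fields; locality, additivity and the Leibniz
rule reduce $\nabla W$ to the coefficients of $\nabla\partial_d$. -/
theorem components_cov (he : e ∈ IsManifold.maximalAtlas (𝓡 m) ∞ M) (cov : LinearConnection m M)
    {W : Π y : M, TangentSpace (𝓡 m) y} (hW : SmoothFieldOn W e.source) {x : M}
    (hx : x ∈ e.source) (u : TangentSpace (𝓡 m) x) (c : Fin m) :
    components e x (cov W x u) c =
      ∑ a, components e x u a * covDeriv (connCoord e cov) (vectorCoord e W) a c (e x) := by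
  have hz := e.map_source hx
  have hs := e.open_source.mem_nhds hx
  let F : Fin m → M → ℝ := fun d y => vectorCoord e W (e y) d
  have hFe : ∀ d, F d ∘ e.symm =ᶠ[𝓝 (e x)] fun w => vectorCoord e W w d := by
    intro d
    filter_upwards [e.open_target.mem_nhds hz] with w hw
    simp [F, e.right_inv hw]
  have hFd : ∀ d, DifferentiableAt ℝ (F d ∘ e.symm) (e x) := fun d =>
    (differentiableAt_of_contDiffOn e.open_target (contDiffOn_vectorCoord he hW d)
      hz).congr_of_eventuallyEq (hFe d)
  have hF := fun d u => mvfderiv_eq_fderiv_comp_symm he hx (hFd d) u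
  have hC : ∀ d, MDifferentiableAt (𝓡 m) (𝓡 m).tangent (toBundle (coordField e d)) x := fun d =>
    ((contMDiffOn_coordField he d).contMDiffAt hs).mdifferentiableAt (by simp)
  have hσ : ∀ d, MDifferentiableAt (𝓡 m) (𝓡 m).tangent (toBundle (F d • coordField e d)) x :=
    fun d => MDifferentiableAt.smul_section (hF d 0).1 (hC d)
  have h1 : cov W x = cov (fun y => ∑ d, (F d • coordField e d) y) x := by
    refine cov.isCovariantDerivativeOnUniv.congr_of_eventuallyEq
      ((hW.contMDiffAt hs).mdifferentiableAt (by simp))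
      (MDifferentiableAt.sum_section fun d _ => hσ d) Filter.univ_mem ?_
    filter_upwards [hs] with y hy
    simp only [Pi.smul_apply', F, vectorCoord_apply hy]
    exact eq_sum_components he hy (W y)
  have h2 : ∀ d, cov (F d • coordField e d) x u =
      F d x • cov (coordField e d) x u + mvfderiv (𝓡 m) (F d) x u • coordField e d x := by
    intro d
    rw [cov.isCovariantDerivativeOnUniv.leibniz (hC d) (hF d 0).1]
    rfl
  have h3 : ∀ d, components e x (cov (coordField e d) x u) c =
      -∑ a, components e x u a * connCoord e cov (e x) (a, c, d) := by
    intro d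
    conv_lhs => rw [eq_sum_components he hx u, map_sum]
    simp only [map_smul]
    rw [components_sum, ← Finset.sum_neg_distrib]
    simp [connCoord_apply cov hx]
  have h4 : cov W x u = ∑ d, (F d x • cov (coordField e d) x u +
      mvfderiv (𝓡 m) (F d) x u • coordField e d x) := by
    rw [h1, cov_sum cov _ _ fun d _ => hσ d, _root_.sum_apply]
    exact Finset.sum_congr rfl fun d _ => h2 d
  rw [h4, Finset.sum_add_distrib]
  have h5 : components e x (∑ d, F d x • cov (coordField e d) x u +
      ∑ d, mvfderiv (𝓡 m) (F d) x u • coordField e d x) =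
      components e x (∑ d, F d x • cov (coordField e d) x u) +
      components e x (∑ d, mvfderiv (𝓡 m) (F d) x u • coordField e d x) := map_add _ _ _
  rw [h5, components_sum, components_sum]
  have h6 : ∀ d, mvfderiv (𝓡 m) (F d) x u =
      ∑ a, components e x u a * pderiv a (fun w => vectorCoord e W w d) (e x) := by
    intro d
    rw [(hF d u).2, (hFe d).fderiv_eq, fderiv_apply_eq_sum_pderiv]
  simp only [components_coordField he hx, PiLp.add_apply, WithLp.ofLp_sum, Finset.sum_apply,
    WithLp.ofLp_smul, Pi.smul_apply, smul_eq_mul, h3, h6, F]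
  simp only [basisVec, PiLp.single_apply, mul_ite, mul_one, mul_zero, Finset.sum_ite_eq,
    Finset.mem_univ, if_true, covDeriv, mul_sub, Finset.sum_sub_distrib, Finset.mul_sum, mul_neg,
    Finset.sum_neg_distrib]
  rw [Finset.sum_comm, add_comm, ← sub_eq_add_neg]
  congr 1
  exact Finset.sum_congr rfl fun a _ => Finset.sum_congr rfl fun d _ => by ring

end Manifold

/-! ### Smooth coefficients and the Levi-Civita conditions in a chart. -/

section

variable {m : ℕ} {M : Type*} [TopologicalSpace M] [ChartedSpace (Vec m) M]
  {e : OpenPartialHomeomorph M (Vec m)} [IsManifold (𝓡 m) ∞ M]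

/-- Smoothness of the connection concerns globally smooth fields, whereas coordinate fields are
smooth only on the chart domain. A bump function extends the field, and locality shows that the
covariant derivative is unchanged near the point. The Hausdorff property serves to make the
extension smooth. -/
theorem smoothFieldOn_cov [T2Space M] {cov : LinearConnection m M}
    (hcov : CovariantDerivative.ContMDiffCovariantDerivative cov ∞)
    {V W : Π y : M, TangentSpace (𝓡 m) y} {s : Set M} (hs : IsOpen s) (hV : SmoothFieldOn V s)
    (hW : SmoothFieldOn W s) : SmoothFieldOn (fun y => cov W y (V y)) s := by
  intro x hx
  refine ContMDiffAt.contMDiffWithinAt ?_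
  obtain ⟨f, -, hf⟩ := (SmoothBumpFunction.nhds_basis_tsupport (I := 𝓡 m) x).mem_iff.1
    (hs.mem_nhds hx)
  let ψ : M → ℝ := f
  have hψ : ContMDiff (𝓡 m) 𝓘(ℝ, ℝ) ∞ ψ := f.contMDiff
  have h1 : ContMDiff (𝓡 m) (𝓡 m).tangent ∞ (toBundle (ψ • W)) :=
    ContMDiffOn.smul_section_of_tsupport hψ.contMDiffOn hs hf hW
  have h2 := (hcov.contMDiff.contMDiff (σ := ψ • W) h1.contMDiffOn).contMDiffAt
    (Filter.univ_mem (f := 𝓝 x))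
  have h3 := h2.clm_bundle_apply (hV.contMDiffAt (hs.mem_nhds hx))
  refine h3.congr_of_eventuallyEq ?_
  -- The covariant derivative at `y` depends on the germ there, so the bump must be one on a
  -- neighbourhood of each nearby `y`, not merely at `y`.
  filter_upwards [f.eventuallyEq_one.eventually_nhds, hs.mem_nhds hx] with y hy hys
  have h4 : cov W y = cov (ψ • W) y := by
    refine cov.isCovariantDerivativeOnUniv.congr_of_eventuallyEq
      ((hW.contMDiffAt (hs.mem_nhds hys)).mdifferentiableAt (by simp))
      ((h1 y).mdifferentiableAt (by simp)) Filter.univ_mem ?_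
    filter_upwards [hy] with w hw
    have : ψ w = 1 := hw
    simp [this]
  exact congrArg (fun L => (⟨y, L (V y)⟩ : TangentBundle (𝓡 m) M)) h4

theorem contDiffOn_connCoord [T2Space M] (he : e ∈ IsManifold.maximalAtlas (𝓡 m) ∞ M)
    {cov : LinearConnection m M} (hcov : CovariantDerivative.ContMDiffCovariantDerivative cov ∞)
    (i : ConnIdx m) : ContDiffOn ℝ ∞ (fun z => connCoord e cov z i) e.target :=
  (contDiffOn_vectorCoord he (smoothFieldOn_cov hcov e.open_source
    (contMDiffOn_coordField he i.1) (contMDiffOn_coordField he i.2.2)) i.2.1).neg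

theorem mlieBracket_coordField (he : e ∈ IsManifold.maximalAtlas (𝓡 m) ∞ M) {x : M}
    (hx : x ∈ e.source) (a b : Fin m) :
    VectorField.mlieBracket (𝓡 m) (coordField e a) (coordField e b) x = 0 := by
  refine components_injective he hx ?_
  rw [← vectorCoord_apply hx]
  ext c
  rw [components_mlieBracket he (contMDiffOn_coordField he a) (contMDiffOn_coordField he b)
    (e.map_source hx)]
  have h : ∀ a d, pderiv d (fun w => vectorCoord e (coordField e a) w c) (e x) = 0 := by
    intro a d
    rw [pderiv_congr (g := fun _ => (basisVec a : Vec m) c), pderiv_const]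
    filter_upwards [e.open_target.mem_nhds (e.map_source hx)] with w hw
    rw [vectorCoord_coordField he hw]
  rw [show components e x 0 = (0 : Vec m) from map_zero _]
  simp [h]

theorem connCoord_symm (he : e ∈ IsManifold.maximalAtlas (𝓡 m) ∞ M) {cov : LinearConnection m M}
    (htor : cov.torsion = 0) {z : Vec m} (hz : z ∈ e.target) (a b c : Fin m) :
    connCoord e cov z (a, b, c) = connCoord e cov z (c, b, a) := by
  have hx := e.map_target hz
  have hC : ∀ d, MDifferentiableAt (𝓡 m) (𝓡 m).tangent (toBundle (coordField e d)) (e.symm z) :=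
    fun d => ((contMDiffOn_coordField he d).contMDiffAt
      (e.open_source.mem_nhds hx)).mdifferentiableAt (by simp)
  have h := cov.torsion_eq_zero_iff.1 htor (hC a) (hC c)
  rw [mlieBracket_coordField he hx, sub_eq_zero] at h
  simp only [connCoord]
  rw [h]

theorem contDiffOn_metricCoord (he : e ∈ IsManifold.maximalAtlas (𝓡 m) ∞ M)
    (g : PseudoMetric m M) (a b : Fin m) :
    ContDiffOn ℝ ∞ (fun z => metricCoord e g z a b) e.target := by
  intro z hz
  refine ContDiffAt.contDiffWithinAt ?_
  have hs := e.open_source.mem_nhds (e.map_target hz)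
  have h1 : ContMDiffAt (𝓡 m) ((𝓡 m).prod 𝓘(ℝ, ℝ)) ∞
      (fun y => Bundle.TotalSpace.mk' ℝ (E := Bundle.Trivial M ℝ) y
        (g.inner y (coordField e a y) (coordField e b y))) (e.symm z) := by
    apply ContMDiffAt.clm_bundle_apply₂ (F₁ := Vec m) (F₂ := Vec m)
    · exact g.contMDiff (e.symm z)
    · exact (contMDiffOn_coordField he a).contMDiffAt hs
    · exact (contMDiffOn_coordField he b).contMDiffAt hs
  have h2 : ContMDiffAt (𝓡 m) 𝓘(ℝ, ℝ) ∞
      (fun y => g.inner y (coordField e a y) (coordField e b y)) (e.symm z) := by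
    simp only [Bundle.contMDiffAt_totalSpace] at h1
    exact h1.2
  exact (h2.comp z (contMDiffAt_symm_of_mem_maximalAtlas he hz)).contDiffAt

/-- A kernel vector of the matrix would be the component vector of a nonzero tangent vector
orthogonal to the whole tangent space. -/
theorem det_metricCoord_ne_zero (he : e ∈ IsManifold.maximalAtlas (𝓡 m) ∞ M)
    (g : PseudoMetric m M) {z : Vec m} (hz : z ∈ e.target) : (metricCoord e g z).det ≠ 0 := by
  intro h0
  have hx := e.map_target hz
  obtain ⟨v, hv, hGv⟩ := Matrix.exists_mulVec_eq_zero_iff.2 h0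
  set w : TangentSpace (𝓡 m) (e.symm z) := ∑ b, v b • coordField e b (e.symm z) with hw
  have h1 : w = 0 := by
    refine g.nondegenerate _ _ fun u => ?_
    rw [g.symm, eq_sum_components he hx u]
    simp only [map_sum, map_smul, _root_.sum_apply, _root_.smul_apply, smul_eq_mul]
    refine Finset.sum_eq_zero fun a _ => ?_
    have h2 : ∑ b, metricCoord e g z a b * v b = 0 := congrFun hGv a
    have h3 : g.inner (e.symm z) (coordField e a (e.symm z)) w = 0 := by
      rw [hw, map_sum, ← h2]
      refine Finset.sum_congr rfl fun b _ => ?_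
      rw [map_smul, smul_eq_mul, mul_comm]
      rfl
    rw [h3, mul_zero]
  have h4 : components e (e.symm z) w = (0 : Vec m) := by
    rw [h1]
    exact map_zero _
  rw [hw, components_sum] at h4
  simp only [components_coordField he hx] at h4
  refine hv (funext fun a => ?_)
  have h5 := congrArg (fun u : Vec m => u a) h4
  simpa [basisVec, PiLp.single_apply, Pi.single_apply] using h5

theorem pderiv_metricCoord (he : e ∈ IsManifold.maximalAtlas (𝓡 m) ∞ M)
    {cov : LinearConnection m M} {g : PseudoMetric m M} (hg : IsMetric cov g) {z : Vec m}
    (hz : z ∈ e.target) (a b c : Fin m) :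
    pderiv c (fun w => metricCoord e g w a b) z =
      -∑ d, (connCoord e cov z (c, d, a) * metricCoord e g z d b +
        connCoord e cov z (c, d, b) * metricCoord e g z a d) := by
  have hx := e.map_target hz
  have hC : ∀ d, MDifferentiableAt (𝓡 m) (𝓡 m).tangent (toBundle (coordField e d)) (e.symm z) :=
    fun d => ((contMDiffOn_coordField he d).contMDiffAt
      (e.open_source.mem_nhds hx)).mdifferentiableAt (by simp)
  have h1 := hg (e.symm z) (coordField e c (e.symm z)) _ _ (hC a) (hC b)
  have h2 := (mvfderiv_eq_fderiv_comp_symm he hx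
    (F := fun y => g.inner y (coordField e a y) (coordField e b y))
    (by
      rw [e.right_inv hz]
      exact differentiableAt_of_contDiffOn e.open_target (contDiffOn_metricCoord he g a b) hz)
    (coordField e c (e.symm z))).2
  rw [h1, components_coordField he hx, e.right_inv hz] at h2
  have h3 : ∀ d, cov (coordField e d) (e.symm z) (coordField e c (e.symm z)) =
      ∑ k, (-connCoord e cov z (c, k, d)) • coordField e k (e.symm z) := by
    intro d
    conv_lhs => rw [eq_sum_components he hx
      (cov (coordField e d) (e.symm z) (coordField e c (e.symm z)))]
    simp [connCoord]
  refine h2.symm.trans ?_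
  rw [h3, h3, map_sum, map_sum, _root_.sum_apply, ← Finset.sum_add_distrib,
    ← Finset.sum_neg_distrib]
  refine Finset.sum_congr rfl fun d _ => ?_
  simp only [map_smul, _root_.smul_apply, smul_eq_mul, metricCoord, Matrix.of_apply]
  ring

theorem isLeviCivitaOn [T2Space M] (he : e ∈ IsManifold.maximalAtlas (𝓡 m) ∞ M)
    {cov : LinearConnection m M} (hcov : CovariantDerivative.ContMDiffCovariantDerivative cov ∞)
    (htor : cov.torsion = 0) {g : PseudoMetric m M} (hg : IsMetric cov g) :
    IsLeviCivitaOn e.target (metricCoord e g) (connCoord e cov) where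
  isOpen := e.open_target
  smooth_metric := contDiffOn_metricCoord he g
  smooth_conn := contDiffOn_connCoord he hcov
  det_ne_zero _ hz := det_metricCoord_ne_zero he g hz
  metric_symm _ _ _ _ := g.symm _ _ _
  conn_symm _ hz := connCoord_symm he htor hz
  metricity _ hz := pderiv_metricCoord he hg hz

/-! ### Curvature and Lie derivative in a chart -/

theorem vectorCoord_cov (he : e ∈ IsManifold.maximalAtlas (𝓡 m) ∞ M) (cov : LinearConnection m M)
    {W : Π y : M, TangentSpace (𝓡 m) y} (hW : SmoothFieldOn W e.source) {z : Vec m}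
    (hz : z ∈ e.target) (a c : Fin m) :
    vectorCoord e (fun y => cov W y (coordField e a y)) z c =
      covDeriv (connCoord e cov) (vectorCoord e W) a c z := by
  have h := components_cov he cov hW (e.map_target hz) (coordField e a (e.symm z)) c
  rw [components_coordField he (e.map_target hz), e.right_inv hz] at h
  refine h.trans ?_
  simp [basisVec, PiLp.single_apply]

/-- Coordinate fields commute, so only the commutator of covariant derivatives remains; second
partials and mixed first-order terms of the field cancel in it. -/
theorem components_curvature [T2Space M] (he : e ∈ IsManifold.maximalAtlas (𝓡 m) ∞ M)
    {cov : LinearConnection m M} (hcov : CovariantDerivative.ContMDiffCovariantDerivative cov ∞)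
    {W : Π y : M, TangentSpace (𝓡 m) y} (hW : SmoothFieldOn W e.source) {z : Vec m}
    (hz : z ∈ e.target) (a b c : Fin m) :
    components e (e.symm z) (curvature cov (coordField e a) (coordField e b) W (e.symm z)) c =
      ∑ k, riemann (jetProlong (connCoord e cov) z) a b c k * vectorCoord e W z k := by
  set Γ := connCoord e cov
  have hΓ := contDiffOn_connCoord he hcov
  have hX := contDiffOn_vectorCoord he hW
  have h2 : ∀ a b, components e (e.symm z)
      (cov (fun y => cov W y (coordField e b y)) (e.symm z) (coordField e a (e.symm z))) c =
      pderiv a (covDeriv Γ (vectorCoord e W) b c) z -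
        ∑ k, Γ z (a, c, k) * covDeriv Γ (vectorCoord e W) b k z := by
    intro a b
    have h := vectorCoord_cov he cov (smoothFieldOn_cov hcov e.open_source
      (contMDiffOn_coordField he b) hW) hz a c
    refine h.trans ?_
    rw [covDeriv]
    congr 1
    · refine pderiv_congr ?_ a
      filter_upwards [e.open_target.mem_nhds hz] with w hw
      exact vectorCoord_cov he cov hW hw b c
    · exact Finset.sum_congr rfl fun k _ => by rw [vectorCoord_cov he cov hW hz b k]
  have h3 : components e (e.symm z) (curvature cov (coordField e a) (coordField e b) W
      (e.symm z)) = components e (e.symm z)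
      (cov (fun y => cov W y (coordField e b y)) (e.symm z) (coordField e a (e.symm z))) -
      components e (e.symm z)
      (cov (fun y => cov W y (coordField e a y)) (e.symm z) (coordField e b (e.symm z))) := by
    rw [curvature, mlieBracket_coordField he (e.map_target hz), map_zero, sub_zero]
    exact map_sub _ _ _
  rw [h3, PiLp.sub_apply, h2, h2, pderiv_covDeriv e.open_target hΓ hX hz,
    pderiv_covDeriv e.open_target hΓ hX hz,
    pderiv_comm ((hX c).contDiffAt (e.open_target.mem_nhds hz)) a b]
  have q : ∀ a b, ∑ k, (Γ z (a, c, k) * ∑ l, Γ z (b, k, l) * vectorCoord e W z l) =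
      ∑ l, ∑ k, Γ z (a, c, k) * Γ z (b, k, l) * vectorCoord e W z l := by
    intro a b
    simp only [Finset.mul_sum, mul_assoc]
    exact Finset.sum_comm
  simp only [riemann, jetProlong, covDeriv, mul_sub, sub_mul, add_mul, Finset.sum_sub_distrib,
    Finset.sum_add_distrib, q, Finset.sum_mul]
  ring

/-- Everything follows from $[X,\partial_d]^k=-\partial_dX^k$ (`hbc`), applied to each of the three
terms of the definition; vanishing torsion is not needed. -/
theorem components_lieDerivConnection [T2Space M] (he : e ∈ IsManifold.maximalAtlas (𝓡 m) ∞ M)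
    {cov : LinearConnection m M} (hcov : CovariantDerivative.ContMDiffCovariantDerivative cov ∞)
    {X : Π y : M, TangentSpace (𝓡 m) y} (hX : SmoothFieldOn X e.source) {z : Vec m}
    (hz : z ∈ e.target) (a b c : Fin m) :
    components e (e.symm z)
        (lieDerivConnection cov X (coordField e a) (coordField e c) (e.symm z)) b =
      lieConn (vectorCoord e X) (jetProlong (connCoord e cov) z) a b c := by
  have hx := e.map_target hz
  have hC := fun d => contMDiffOn_coordField he (m := m) d
  have hbr : ∀ d, SmoothFieldOn (VectorField.mlieBracket (𝓡 m) X (coordField e d)) e.source := by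
    have : IsManifold (𝓡 m) (∞ + 1) M := IsManifold.of_le (n := ∞) (by simp)
    have h2 : IsManifold (𝓡 m) (minSmoothness ℝ 2) M := IsManifold.of_le (n := ∞) (by simp; decide)
    intro d x hx
    have hs := e.open_source.mem_nhds hx
    exact (ContMDiffAt.mlieBracket_vectorField (m := ⊤) (n := ⊤) (hX.contMDiffAt hs)
      ((hC d).contMDiffAt hs) (by simp)).contMDiffWithinAt
  have hbc : ∀ d k, ∀ w ∈ e.target,
      vectorCoord e (VectorField.mlieBracket (𝓡 m) X (coordField e d)) w k =
        -pderiv d (fun w => vectorCoord e X w k) w := by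
    intro d k w hw
    rw [components_mlieBracket he hX (hC d) hw]
    have h : ∀ l, pderiv l (fun w => vectorCoord e (coordField e d) w k) w = 0 := by
      intro l
      rw [pderiv_congr (g := fun _ => (basisVec d : Vec m) k), pderiv_const]
      filter_upwards [e.open_target.mem_nhds hw] with w hw
      rw [vectorCoord_coordField he hw]
    simp [h, vectorCoord_coordField he hw, basisVec, PiLp.single_apply]
  have t1 : components e (e.symm z) (cov (VectorField.mlieBracket (𝓡 m) X (coordField e c))
      (e.symm z) (coordField e a (e.symm z))) b =
      -pderiv a (pderiv c fun w => vectorCoord e X w b) z +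
        ∑ d, connCoord e cov z (a, b, d) * pderiv c (fun w => vectorCoord e X w d) z := by
    refine (vectorCoord_cov he cov (hbr c) hz a b).trans ?_
    rw [covDeriv, sub_eq_add_neg, ← Finset.sum_neg_distrib]
    congr 1
    · rw [← pderiv_neg]
      refine pderiv_congr ?_ a
      filter_upwards [e.open_target.mem_nhds hz] with w hw using hbc c b w hw
    · refine Finset.sum_congr rfl fun d _ => ?_
      rw [hbc c d z hz]
      ring
  have t2 : components e (e.symm z) (VectorField.mlieBracket (𝓡 m) X
      (fun y => cov (coordField e c) y (coordField e a y)) (e.symm z)) b =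
      ∑ d, (-(vectorCoord e X z d * pderiv d (fun w => connCoord e cov w (a, b, c)) z) +
        connCoord e cov z (a, d, c) * pderiv d (fun w => vectorCoord e X w b) z) := by
    refine (components_mlieBracket he hX (smoothFieldOn_cov hcov e.open_source (hC a) (hC c))
      hz b).trans (Finset.sum_congr rfl fun d _ => ?_)
    have h1 : ∀ k, (fun w => vectorCoord e (fun y => cov (coordField e c) y (coordField e a y))
        w k) = fun w => -connCoord e cov w (a, k, c) := by
      intro k
      funext w
      simp [connCoord, vectorCoord]
    rw [h1 b, congrFun (h1 d) z, pderiv_neg]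
    ring
  have t3 : components e (e.symm z) (cov (coordField e c) (e.symm z)
      (VectorField.mlieBracket (𝓡 m) X (coordField e a) (e.symm z))) b =
      ∑ d, pderiv a (fun w => vectorCoord e X w d) z * connCoord e cov z (d, b, c) := by
    rw [components_cov he cov (hC c) hx, e.right_inv hz]
    refine Finset.sum_congr rfl fun d _ => ?_
    have h1 : components e (e.symm z) (VectorField.mlieBracket (𝓡 m) X (coordField e a)
        (e.symm z)) d = -pderiv a (fun w => vectorCoord e X w d) z := hbc a d z hz
    rw [h1, ← vectorCoord_cov he cov (hC c) hz d b]
    simp only [connCoord, vectorCoord]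
    ring
  have h3 : components e (e.symm z) (lieDerivConnection cov X (coordField e a) (coordField e c)
      (e.symm z)) = components e (e.symm z) (cov (VectorField.mlieBracket (𝓡 m) X
        (coordField e c)) (e.symm z) (coordField e a (e.symm z))) -
      (components e (e.symm z) (VectorField.mlieBracket (𝓡 m) X
        (fun y => cov (coordField e c) y (coordField e a y)) (e.symm z)) -
      components e (e.symm z) (cov (coordField e c) (e.symm z)
        (VectorField.mlieBracket (𝓡 m) X (coordField e a) (e.symm z)))) := by
    rw [lieDerivConnection]
    exact (map_sub _ _ _).trans (congrArg _ (map_sub _ _ _))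
  rw [h3, PiLp.sub_apply, PiLp.sub_apply, t1, t2, t3, lieConn]
  simp only [jetProlong, Finset.sum_add_distrib, Finset.sum_sub_distrib, Finset.sum_neg_distrib]
  ring

/-- In the chart `e`, the Komar lift along `jΓ` is `X ⌋ dΓ` plus its tensorial vertical part. -/
theorem komarLift_jetProlong_connCoord [T2Space M] (he : e ∈ IsManifold.maximalAtlas (𝓡 m) ∞ M)
    {cov : LinearConnection m M} (hcov : CovariantDerivative.ContMDiffCovariantDerivative cov ∞)
    {X : Π y : M, TangentSpace (𝓡 m) y} (hX : SmoothFieldOn X e.source) {z : Vec m}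
    (hz : z ∈ e.target) :
    komarLift (vectorCoord e X) (jetProlong (connCoord e cov) z) =
      (vectorCoord e X z, fun i =>
        (∑ a, vectorCoord e X z a * pderiv a (fun w => connCoord e cov w i) z) +
          verticalPart e cov X z i.1 i.2.1 i.2.2) := by
  refine Prod.ext rfl (funext fun i => ?_)
  -- The trace of $w\mapsto R(\partial_b,w)\partial_d$ in the coordinate frame is the contraction
  -- $R_{ba}{}^a{}_d$.
  have hric : ∀ b d, ∑ a, components e (e.symm z)
      (curvature cov (coordField e b) (coordField e a) (coordField e d) (e.symm z)) a =
      ricci (jetProlong (connCoord e cov) z) b d := by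
    intro b d
    refine Finset.sum_congr rfl fun a _ => ?_
    rw [components_curvature he hcov (contMDiffOn_coordField he d) hz,
      vectorCoord_coordField he hz]
    simp [basisVec, PiLp.single_apply]
  simp only [komarLift, verticalPart, components_lieDerivConnection he hcov hX hz,
    components_curvature he hcov hX hz, hric]
  simp only [jetProlong]
  ring

end

end MetricAffine

/-! ### Assembly of both claims in an arbitrary chart. -/

theorem mainTheorem6 {n : ℕ} {M : Type*} [TopologicalSpace M] [T2Space M]
    [ChartedSpace (MetricAffine.Vec (n + 2)) M] [IsManifold (𝓡 (n + 2)) ∞ M]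
    -- a smooth torsion-free linear connection `Γ`, i.e. a section `M → C_Γ`
    (cov : MetricAffine.LinearConnection (n + 2) M)
    (hcov : CovariantDerivative.ContMDiffCovariantDerivative cov ∞) (htor : cov.torsion = 0)
    -- any smooth vector field
    (X : Π x : M, TangentSpace (𝓡 (n + 2)) x)
    (hX : ContMDiff (𝓡 (n + 2)) (𝓡 (n + 2)).tangent ∞
      (fun x => (⟨x, X x⟩ : TangentBundle (𝓡 (n + 2)) M)))
    -- any smooth chart of `M`, and the induced coordinates of the jet bundles
    (e : OpenPartialHomeomorph M (MetricAffine.Vec (n + 2)))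
    (he : e ∈ IsManifold.maximalAtlas (𝓡 (n + 2)) ∞ M) :
    -- along `jΓ`, the morphism `Y` is `X ⌋ dl - L_X Γ + Riemann ⌋ X - Ricci ⊗ X`
    (∀ z ∈ e.target,
      MetricAffine.komarLift (MetricAffine.vectorCoord e X)
          (MetricAffine.jetProlong (MetricAffine.connCoord e cov) z) =
        (MetricAffine.vectorCoord e X z, fun i =>
          (∑ a, MetricAffine.vectorCoord e X z a *
            MetricAffine.pderiv a (fun w => MetricAffine.connCoord e cov w i) z) +
          MetricAffine.verticalPart e cov X z i.1 i.2.1 i.2.2)) ∧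
    -- `(j(g,Γ))^* (i_Y C_grav) = J[X]` whenever `Γ` is the Riemannian connection of `g`;
    -- `i_Y` is `i_Z` for an arbitrary vector field `Z` on the jet space projecting on `Y`
    (∀ g : MetricAffine.PseudoMetric (n + 2) M, MetricAffine.IsMetric cov g →
      ∀ Z : MetricAffine.Jet (n + 2) (MetricAffine.FieldIdx (n + 2)) →
          MetricAffine.Jet (n + 2) (MetricAffine.FieldIdx (n + 2)),
        (∀ p, p.1 ∈ e.target →
          ((Z p).1, fun i => (Z p).2.1 (Sum.inr i)) =
            MetricAffine.komarLift (MetricAffine.vectorCoord e X) p.conn) →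
        ∀ z ∈ e.target,
          MetricAffine.pullback (MetricAffine.jetProlong (MetricAffine.fieldCoord e g cov))
              (MetricAffine.interiorProd Z
                (MetricAffine.poincareCartan MetricAffine.gravLagrangian)) z =
            MetricAffine.komarCurrent (MetricAffine.metricCoord e g)
              (MetricAffine.vectorCoord e X) z) := by
  have hXe : MetricAffine.SmoothFieldOn X e.source := hX.contMDiffOn
  refine ⟨fun z hz => MetricAffine.komarLift_jetProlong_connCoord he hcov hXe hz, ?_⟩
  intro g hg Z hZ z hz
  exact (MetricAffine.isLeviCivitaOn he hcov htor hg).pullback_poincareCartan_eq_komarCurrent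
    (MetricAffine.contDiffOn_vectorCoord he hXe) Z hZ hz
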